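/- Let $\{0,1\}^*$ be the set of finite binary strings, and let $|p|$ denote the length of $p\in\{0,1\}^*$. A *prefix-free machine* is a partial computable function $M\colon\{0,1\}^*\to\{0,1\}^*$ such that no string in $\operatorname{Dom} M$ is a prefix of another string in $\operatorname{Dom} M$. A prefix-free machine $U$ is *optimal* if for every prefix-free machine $M$ there is $d\in\mathbb N$ such that for every $p\in\operatorname{Dom} M$ there is $q\in\operatorname{Dom} U$ with $U(q)=M(p)$ and $|q|\le|p|+d$. A real $T$ is *computable* if there is a computable function $f\colon\mathbb N\to\mathbb Q$ with $|T-f(n)|<2^{-n}$ for all $n\in\mathbb N$. A *finite automaton with outputs* in $\{0,1,N\}$ over the input alphabet $\{0,1\}$ consists of a finite set $Q$ of states, a transition function $\delta\colon Q\times\{0,1\}\to Q$, an initial state $q_0\in Q$ and an output function $f\colon Q\to\{0,1,N\}$; its output $M(x)$ on $x=x_1\dots x_n\in\{0,1\}^*$ is $f(q_n)$, where $q_i=\delta(q_{i-1},x_i)$ for $i=1,\dots,n$. An infinite binary sequence $X=X(1)X(2)\dots$, with prefixes $X{\restriction}_n=X(1)\dots X(n)$, is *finite-state strongly predictable* if there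 is such an automaton $M$ for which (i) for every $n\in\mathbb N$, if $M(X{\restriction}_n)\ne N$ then $M(X{\restriction}_n)=X(n+1)$, and (ii) the set $\{n\in\mathbb N\mid M(X{\restriction}_n)\ne N\}$ is infinite. **Theorem.** Let $U$ be an optimal prefix-free machine and let $T$ be a computable real with $0<T<1$. Then the series $$Z(T)=\sum_{p\in\operatorname{Dom} U}2^{-|p|/T}$$ converges, and the base-two expansion of the fractional part of $Z(T)$ with infinitely many zeros is finite-state strongly predictable. -/

import Mathlib

/-! ### Infinite binary sequences and the base-two expansion of a real

A finite binary string is a `List Bool`; an infinite binary sequence is a function `X : ℕ → Bool`,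
where `X n` is the `(n + 1)`-st bit. -/

/-- The first `n` bits of `X`. -/
def bitPrefix (X : ℕ → Bool) (n : ℕ) : List Bool :=
  (List.range n).map X

/-- `X` is the base-two expansion with infinitely many zeros of the fractional part of `α`. -/
def IsBaseTwoExpansion (α : ℝ) (X : ℕ → Bool) : Prop :=
  HasSum (fun n : ℕ => if X n then (1 / 2 : ℝ) ^ (n + 1) else 0) (Int.fract α) ∧
    {n : ℕ | X n = false}.Infinite

/-- The base-two expansion of a real. It is the unique sequence with `IsBaseTwoExpansion α`: see
`isBaseTwoExpansion_baseTwoExpansion` and `IsBaseTwoExpansion.eq_baseTwoExpansion`. -/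
noncomputable def baseTwoExpansion (α : ℝ) (n : ℕ) : Bool :=
  decide (⌊(2 : ℝ) ^ (n + 1) * Int.fract α⌋ % 2 = 1)

theorem floor_pow_succ_mul (x : ℝ) (n : ℕ) :
    ⌊(2 : ℝ) ^ (n + 1) * x⌋ =
      2 * ⌊(2 : ℝ) ^ n * x⌋ + (if ⌊(2 : ℝ) ^ (n + 1) * x⌋ % 2 = 1 then 1 else 0) := by
  have h1 := Int.floor_le ((2 : ℝ) ^ n * x)
  have h2 := Int.lt_floor_add_one ((2 : ℝ) ^ n * x)
  have e : (2 : ℝ) ^ (n + 1) * x = 2 * ((2 : ℝ) ^ n * x) := by ring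
  have h3 : 2 * ⌊(2 : ℝ) ^ n * x⌋ ≤ ⌊(2 : ℝ) ^ (n + 1) * x⌋ := by
    rw [Int.le_floor, e]; push_cast; linarith
  have h4 : ⌊(2 : ℝ) ^ (n + 1) * x⌋ < 2 * ⌊(2 : ℝ) ^ n * x⌋ + 2 := by
    rw [Int.floor_lt, e]; push_cast; linarith
  split_ifs <;> omega

theorem isBaseTwoExpansion_baseTwoExpansion (α : ℝ) :
    IsBaseTwoExpansion α (baseTwoExpansion α) := by
  have hx0 : 0 ≤ Int.fract α := Int.fract_nonneg α
  have hx1 : Int.fract α < 1 := Int.fract_lt_one α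
  unfold IsBaseTwoExpansion baseTwoExpansion
  generalize Int.fract α = x at hx0 hx1 ⊢
  simp only [decide_eq_true_eq, decide_eq_false_iff_not]
  constructor
  · rw [hasSum_iff_tendsto_nat_of_nonneg (by intro i; split_ifs <;> positivity)]
    have key : ∀ n : ℕ, ∑ i ∈ Finset.range n,
        (if ⌊(2 : ℝ) ^ (i + 1) * x⌋ % 2 = 1 then (1 / 2 : ℝ) ^ (i + 1) else 0) =
        ⌊(2 : ℝ) ^ n * x⌋ * (1 / 2 : ℝ) ^ n := by
      intro n
      induction n with
      | zero => simp [Int.floor_eq_zero_iff.2 ⟨hx0, hx1⟩]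
      | succ n ih =>
        rw [Finset.sum_range_succ, ih]
        have h := floor_pow_succ_mul x n
        by_cases hp : ⌊(2 : ℝ) ^ (n + 1) * x⌋ % 2 = 1
        · rw [if_pos hp] at h ⊢
          rw [h]; push_cast; ring
        · rw [if_neg hp] at h ⊢
          rw [h]; push_cast; ring
    have hpow : ∀ n : ℕ, (2 : ℝ) ^ n * (1 / 2 : ℝ) ^ n = 1 := by
      intro n; rw [← mul_pow]; norm_num
    have hlim : Filter.Tendsto (fun n : ℕ => x - (1 / 2 : ℝ) ^ n) Filter.atTop (nhds x) := by
      simpa using tendsto_const_nhds.sub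
        (tendsto_pow_atTop_nhds_zero_of_lt_one (r := (1 / 2 : ℝ)) (by norm_num) (by norm_num))
    refine tendsto_of_tendsto_of_tendsto_of_le_of_le hlim tendsto_const_nhds ?_ ?_
    · intro n
      simp only [key]
      have h1 := (Int.lt_floor_add_one ((2 : ℝ) ^ n * x)).le
      have h2 := mul_le_mul_of_nonneg_right h1 (by positivity : (0 : ℝ) ≤ (1 / 2) ^ n)
      have h3 := hpow n
      have h4 : (2 : ℝ) ^ n * x * (1 / 2) ^ n = x := by
        rw [mul_right_comm, h3, one_mul]
      rw [h4, add_mul] at h2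
      linarith
    · intro n
      simp only [key]
      have h1 := Int.floor_le ((2 : ℝ) ^ n * x)
      have h2 := mul_le_mul_of_nonneg_right h1 (by positivity : (0 : ℝ) ≤ (1 / 2) ^ n)
      rwa [mul_right_comm, hpow n, one_mul] at h2
  · intro hfin
    obtain ⟨N, hN⟩ := hfin.bddAbove
    have hodd : ∀ n, N < n → ⌊(2 : ℝ) ^ (n + 1) * x⌋ % 2 = 1 := by
      intro n hn
      by_contra hc
      exact absurd (hN hc) (by omega)
    have hdouble : ∀ k : ℕ, 1 - Int.fract ((2 : ℝ) ^ (N + 1 + k) * x) =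
        2 ^ k * (1 - Int.fract ((2 : ℝ) ^ (N + 1) * x)) := by
      intro k
      induction k with
      | zero => simp
      | succ k ih =>
        have h := floor_pow_succ_mul x (N + 1 + k)
        rw [if_pos (hodd (N + 1 + k) (by omega))] at h
        rw [pow_succ, mul_right_comm, ← ih]
        unfold Int.fract
        rw [← add_assoc, h]
        push_cast
        ring
    have hpos : 0 < 1 - Int.fract ((2 : ℝ) ^ (N + 1) * x) :=
      sub_pos.2 (Int.fract_lt_one _)
    obtain ⟨k, hk⟩ := pow_unbounded_of_one_lt
      (1 / (1 - Int.fract ((2 : ℝ) ^ (N + 1) * x))) (one_lt_two)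
    rw [div_lt_iff₀ hpos, ← hdouble k] at hk
    linarith [Int.fract_nonneg ((2 : ℝ) ^ (N + 1 + k) * x)]

theorem IsBaseTwoExpansion.eq_baseTwoExpansion {α : ℝ} {X : ℕ → Bool}
    (h : IsBaseTwoExpansion α X) : X = baseTwoExpansion α := by
  have hgeo : HasSum (fun n : ℕ => (1 / 2 : ℝ) ^ (n + 1)) 1 := by
    simpa [pow_succ', div_eq_mul_inv] using hasSum_geometric_two' 1
  have main : ∀ (n : ℕ) (X : ℕ → Bool) (x : ℝ),
      HasSum (fun n : ℕ => if X n then (1 / 2 : ℝ) ^ (n + 1) else 0) x →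
      {n : ℕ | X n = false}.Infinite →
      X n = decide (⌊(2 : ℝ) ^ (n + 1) * x⌋ % 2 = 1) := by
    intro n
    induction n with
    | zero =>
      intro X x hX hinf
      have h0 := (hasSum_nat_add_iff' 1).2 hX
      simp only [Finset.range_one, Finset.sum_singleton, zero_add, pow_one] at h0
      have hpos : 0 ≤ x - (if X 0 then (1 / 2 : ℝ) else 0) :=
        h0.nonneg (fun i => by split_ifs <;> positivity)
      have hg := (hasSum_nat_add_iff' 1).2 hgeo
      simp only [Finset.range_one, Finset.sum_singleton, zero_add, pow_one] at hg
      obtain ⟨m, hm, hm0⟩ := hinf.exists_gt 0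
      obtain ⟨k, rfl⟩ : ∃ k, m = k + 1 := ⟨m - 1, by omega⟩
      have hlt : x - (if X 0 then (1 / 2 : ℝ) else 0) < 1 - 1 / 2 := by
        refine hasSum_lt (i := k) ?_ ?_ h0 hg
        · intro i
          dsimp only
          split_ifs
          · exact le_rfl
          · positivity
        · have hm' : X (k + 1) = false := hm
          simp only [hm']
          simp
      cases hX0 : X 0
      · rw [hX0] at hpos hlt
        simp only [Bool.false_eq_true, if_false] at hpos hlt
        have hf : ⌊(2 : ℝ) ^ (0 + 1) * x⌋ = 0 := by
          rw [Int.floor_eq_zero_iff]; constructor <;> norm_num <;> linarith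
        rw [hf]; rfl
      · rw [hX0] at hpos hlt
        simp only [if_true] at hpos hlt
        have hf : ⌊(2 : ℝ) ^ (0 + 1) * x⌋ = 1 := by
          rw [Int.floor_eq_iff]; constructor <;> norm_num <;> linarith
        rw [hf]; rfl
    | succ n ih =>
      intro X x hX hinf
      have h0 := (hasSum_nat_add_iff' 1).2 hX
      simp only [Finset.range_one, Finset.sum_singleton, zero_add, pow_one] at h0
      have h1 := h0.mul_left 2
      have hshift : HasSum (fun i : ℕ => if X (i + 1) then (1 / 2 : ℝ) ^ (i + 1) else 0)
          (2 * (x - if X 0 then (1 / 2 : ℝ) else 0)) := by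
        have e : (fun i : ℕ => if X (i + 1) then (1 / 2 : ℝ) ^ (i + 1) else 0) =
            fun i : ℕ => 2 * if X (i + 1) then (1 / 2 : ℝ) ^ (i + 1 + 1) else 0 := by
          funext i
          split_ifs
          · ring
          · simp
        rw [e]
        exact h1
      have hinf' : {i : ℕ | X (i + 1) = false}.Infinite := by
        rw [Set.infinite_iff_exists_gt]
        intro a
        obtain ⟨m, hm, hma⟩ := hinf.exists_gt (a + 1)
        refine ⟨m - 1, ?_, by omega⟩
        have : m - 1 + 1 = m := by omega
        simpa [this] using hm
      have := ih (fun i => X (i + 1)) _ hshift hinf'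
      rw [this]
      congr 1
      have e : (2 : ℝ) ^ (n + 1) * (2 * (x - if X 0 then (1 / 2 : ℝ) else 0)) =
          (2 : ℝ) ^ (n + 1 + 1) * x - ((2 * (if X 0 then 2 ^ n else 0) : ℤ) : ℝ) := by
        split_ifs <;> push_cast <;> ring
      rw [e, Int.floor_sub_intCast, Int.sub_mul_emod_self_left]
  funext n
  exact main n X _ h.1 h.2

/-! ### Computable reals, prefix-free machines, the partition function -/

/-- A real `α` is computable if some computable sequence of rationals `f` satisfies
`|α - f n| < 2⁻ⁿ` for all `n`. A sequence of rationals is computable if the numerator and the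
denominator of its `n`-th term are computable functions of `n`. -/
def IsComputableReal (α : ℝ) : Prop :=
  ∃ f : ℕ → ℚ, Computable (fun n => (f n).num) ∧ Computable (fun n => (f n).den) ∧
    ∀ n : ℕ, |α - (f n : ℝ)| < (1 / 2 : ℝ) ^ n

/-- No string in `S` is a prefix of another string in `S`. -/
def PrefixFree (S : Set (List Bool)) : Prop :=
  ∀ p ∈ S, ∀ q ∈ S, p <+: q → p = q

/-- A prefix-free machine: a partial computable function from strings to strings with prefix-free
domain. -/
def IsPrefixFreeMachine (M : List Bool →. List Bool) : Prop :=
  Partrec M ∧ PrefixFree M.Dom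

/-- An optimal prefix-free machine. -/
def IsOptimalPrefixFreeMachine (U : List Bool →. List Bool) : Prop :=
  IsPrefixFreeMachine U ∧
    ∀ M : List Bool →. List Bool, IsPrefixFreeMachine M →
      ∃ d : ℕ, ∀ p x : List Bool, x ∈ M p → ∃ q : List Bool, x ∈ U q ∧ q.length ≤ p.length + d

/-- The term `2 ^ (-|p| / T)` of the partition function. -/
noncomputable def partitionTerm (U : List Bool →. List Bool) (T : ℝ) (p : U.Dom) : ℝ :=
  (2 : ℝ) ^ (-((p : List Bool).length : ℝ) / T)

/-- The partition function `Z(T)` of the machine `U`. -/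
noncomputable def partitionFunction (U : List Bool →. List Bool) (T : ℝ) : ℝ :=
  ∑' p : U.Dom, partitionTerm U T p

/-! ### Finite automata with outputs and finite-state strong predictability -/

/-- A finite automaton with outputs, with set of states `Q`, input alphabet `A` and output
alphabet `Γ` (the three sets are required to be finite where the structure is used). -/
structure OutputAutomaton (Q A Γ : Type) where
  /-- the transition function -/
  step : Q → A → Q
  /-- the initial state -/
  start : Q
  /-- the output function from final states -/
  out : Q → Γ

/-- The output of the automaton on a word, read from left to right. -/
def OutputAutomaton.output {Q A Γ : Type} (M : OutputAutomaton Q A Γ) (x : List A) : Γ :=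
  M.out (x.foldl M.step M.start)

/-- `X` is finite-state strongly predictable. The output alphabet `{0, 1, N}` is `Option Bool`, and
`none` stands for `N` (no prediction). -/
def FiniteStateStronglyPredictable (X : ℕ → Bool) : Prop :=
  ∃ (Q : Type) (_ : Finite Q) (M : OutputAutomaton Q Bool (Option Bool)),
    (∀ n : ℕ, M.output (bitPrefix X n) ≠ none → M.output (bitPrefix X n) = some (X n)) ∧
    {n : ℕ | M.output (bitPrefix X n) ≠ none}.Infinite

/-!
Let `α = Z(T)`, let `w p = 2 ^ (-|p| / T)`, and let `a s` be increasing computable lower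
approximations of `α` obtained from the programs seen to halt by stage `s`. Summability is Kraft's
inequality, since `w p ≤ 2 ^ (-|p|)`.

*The expansion has no long blocks of zeros.* Whenever the first `n` bits of `a s` change from one
stage to the next, a string that `U` has not yet produced is requested to have a program of length
`T n + O(1)`. Suppose that these requests can be served by a prefix-free machine. By optimality `U`
has a program `q` of length at most `T n + O(1)` for the requested string, and `q` has not halted yet.
At the stage at which the approximations reach the number `r` given by the first `n` bits of `α`, this
gives `α - r ≥ w q ≥ 2 ^ (-n - O(1))`, so the number of zeros that follow is bounded
(`exists_le_fract_partitionSum`).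

*The requests can be served.* By the Kraft–Chaitin theorem
(`exists_prefixFreeMachine_of_requests`) it is enough that their total weight is finite. An
amortized count (`sum_floor_change_le`) shows that for each `n` there are at most
`2 * ∑ s, min (2 ^ n * δ s) 1` changes of the first `n` bits, where `δ s = a (s + 1) - a s`. As
`0 < T < 1`, the sum over `n` of `2 ^ (-T n) * min (2 ^ n * δ) 1` is `O(δ ^ T)`
(`exists_sum_level_le`), and `∑ s, δ s ^ T` is finite because `w p ^ T = 2 ^ (-|p|)`
(`exists_sum_increment_rpow_le`, again Kraft's inequality).

*Prediction.* Either the expansion ends in zeros, or there is a largest `k` such that blocks of `k`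
zeros occur infinitely often. In the latter case almost every such block is followed by a one, which
a finite automaton that counts zeros up to `k` can predict
(`finiteStateStronglyPredictable_of_le_fract`).
-/

/-! ### Closure properties of computable functions -/

namespace Computable

variable {α σ : Type*} [Primcodable α] [Primcodable σ]

theorem nat_add {f g : α → ℕ} (hf : Computable f) (hg : Computable g) :
    Computable fun a => f a + g a :=
  Primrec.nat_add.to_comp.comp hf hg

theorem nat_sub {f g : α → ℕ} (hf : Computable f) (hg : Computable g) :
    Computable fun a => f a - g a :=
  Primrec.nat_sub.to_comp.comp hf hg

theorem nat_mul {f g : α → ℕ} (hf : Computable f) (hg : Computable g) :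
    Computable fun a => f a * g a :=
  Primrec.nat_mul.to_comp.comp hf hg

theorem nat_div {f g : α → ℕ} (hf : Computable f) (hg : Computable g) :
    Computable fun a => f a / g a :=
  Primrec.nat_div.to_comp.comp hf hg

theorem nat_pow {f g : α → ℕ} (hf : Computable f) (hg : Computable g) :
    Computable fun a => f a ^ g a :=
  (Primrec₂.unpaired'.1 Nat.Primrec.pow).to_comp.comp hf hg

theorem decide_nat_eq {f g : α → ℕ} (hf : Computable f) (hg : Computable g) :
    Computable fun a => decide (f a = g a) :=
  (primrecRel_iff_primrec_decide.1 Primrec.eq).to_comp.comp hf hg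

theorem decide_nat_le {f g : α → ℕ} (hf : Computable f) (hg : Computable g) :
    Computable fun a => decide (f a ≤ g a) :=
  (primrecRel_iff_primrec_decide.1 Primrec.nat_le).to_comp.comp hf hg

theorem band {f g : α → Bool} (hf : Computable f) (hg : Computable g) :
    Computable fun a => f a && g a :=
  Primrec.and.to_comp.comp hf hg

theorem bnot {f : α → Bool} (hf : Computable f) : Computable fun a => !f a :=
  Primrec.not.to_comp.comp hf

theorem nat_sum_range {n : α → ℕ} {f : α → ℕ → ℕ} (hn : Computable n) (hf : Computable₂ f) :
    Computable fun a => ∑ i ∈ Finset.range (n a), f a i := by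
  have h : Computable₂ fun (a : α) (p : ℕ × ℕ) => p.2 + f a p.1 :=
    nat_add (snd.comp snd) (hf.comp fst (fst.comp snd))
  refine (nat_rec hn (const 0) h).of_eq fun a => ?_
  induction n a with
  | zero => rfl
  | succ k ih => rw [Finset.sum_range_succ, ← ih]

theorem int_toNat : Computable Int.toNat := by
  have h : Computable fun z : ℤ =>
      bif decide (Encodable.encode z / 2 * 2 = Encodable.encode z) then
        Encodable.encode z / 2 else 0 :=
    Computable.cond (decide_nat_eq (nat_mul (nat_div Computable.encode (const 2)) (const 2))
      Computable.encode) (nat_div Computable.encode (const 2)) (const 0)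
  refine h.of_eq fun z => ?_
  cases z with
  | ofNat n =>
    have : Encodable.encode (Int.ofNat n) = 2 * n := rfl
    rw [this]
    simp [mul_comm]
  | negSucc n =>
    have : Encodable.encode (Int.negSucc n) = 2 * n + 1 := rfl
    rw [this]
    have h2 : ¬ ((2 * n + 1) / 2 * 2 = 2 * n + 1) := by omega
    simp [h2]

end Computable

/-! ### Machines from computable lists of requests -/

/-- The natural number with binary digits `p`, most significant digit first. -/
def binaryValue (p : List Bool) : ℕ :=
  p.foldl (fun k b => 2 * k + b.toNat) 0

theorem binaryValue_append (p t : List Bool) :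
    binaryValue (p ++ t) = binaryValue p * 2 ^ t.length + binaryValue t := by
  induction t using List.reverseRecOn with
  | nil => simp [binaryValue]
  | append_singleton t b ih =>
    have e : ∀ l : List Bool, binaryValue (l ++ [b]) = 2 * binaryValue l + b.toNat := by
      simp [binaryValue]
    rw [← List.append_assoc, e, e, ih, List.length_append, List.length_singleton]
    ring

theorem binaryValue_lt (p : List Bool) : binaryValue p < 2 ^ p.length := by
  induction p using List.reverseRecOn with
  | nil => simp [binaryValue]
  | append_singleton p b ih =>
    rw [binaryValue_append, List.length_append, pow_add]
    have hb : binaryValue [b] < 2 := by cases b <;> simp [binaryValue]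
    simp only [List.length_singleton, pow_one]
    omega

theorem exists_binaryValue_eq (l k : ℕ) (hk : k < 2 ^ l) :
    ∃ p : List Bool, p.length = l ∧ binaryValue p = k := by
  induction l generalizing k with
  | zero => exact ⟨[], rfl, by simp at hk; simp [binaryValue, hk]⟩
  | succ l ih =>
    obtain ⟨p, hp, hv⟩ := ih (k / 2) (by rw [pow_succ] at hk; omega)
    refine ⟨p ++ [decide (k % 2 = 1)], by simp [hp], ?_⟩
    rw [binaryValue_append, hv]
    rcases Nat.mod_two_eq_zero_or_one k with h | h <;> simp [binaryValue, h] <;> omega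

theorem computable_binaryValue : Computable binaryValue := by
  have h : Primrec₂ fun (_ : List Bool) (p : ℕ × Bool) => 2 * p.1 + p.2.toNat :=
    Primrec.nat_add.comp
      (Primrec.nat_mul.comp (Primrec.const 2) (Primrec.fst.comp Primrec.snd))
      ((Primrec.dom_bool Bool.toNat).comp (Primrec.snd.comp Primrec.snd))
  exact (Primrec.list_foldl Primrec.id (Primrec.const 0) h).to_comp

section Requests

variable (act : ℕ → Bool) (len : ℕ → ℕ)

/-- The total weight of the first `i` requests, the request `j` having weight `2 ^ (-len j)` if it
is active and weight `0` otherwise. -/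
noncomputable def requestSum (i : ℕ) : ℝ :=
  ∑ j ∈ Finset.range i, if act j then (1 / 2 : ℝ) ^ len j else 0

/-- A common exponent for the weights of the first `i + 1` requests. -/
def requestExponent (i : ℕ) : ℕ := ∑ j ∈ Finset.range (i + 1), len j

/-- `requestSum act len i` with denominator `2 ^ requestExponent len i`. -/
def requestNumerator (i : ℕ) : ℕ :=
  ∑ j ∈ Finset.range i, cond (act j) (2 ^ (requestExponent len i - len j)) 0

/-- The least `k` with `requestSum act len i ≤ k / 2 ^ (len i + 1)`. -/
def requestCode (i : ℕ) : ℕ :=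
  (requestNumerator act len i * 2 ^ (len i + 1) + (2 ^ requestExponent len i - 1)) /
    2 ^ requestExponent len i

/-- Whether `p` is the program reserved for the request `i`. -/
def isRequestProgram (p : List Bool) (i : ℕ) : Bool :=
  act i && (decide (p.length = len i + 1) && decide (binaryValue p = requestCode act len i))

variable {act len}

theorem requestSum_succ (i : ℕ) : requestSum act len (i + 1) =
    requestSum act len i + if act i then (1 / 2 : ℝ) ^ len i else 0 :=
  Finset.sum_range_succ _ _

theorem requestSum_mono : Monotone (requestSum act len) :=
  monotone_nat_of_le_succ fun i => by
    rw [requestSum_succ]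
    split_ifs <;> simp

theorem requestNumerator_eq (i : ℕ) :
    (requestNumerator act len i : ℝ) = requestSum act len i * 2 ^ requestExponent len i := by
  unfold requestNumerator requestSum
  rw [Finset.sum_mul]
  push_cast
  refine Finset.sum_congr rfl fun j hj => ?_
  have hle : len j ≤ requestExponent len i :=
    Finset.single_le_sum (f := len) (fun _ _ => Nat.zero_le _)
      (Finset.mem_range.2 ((Finset.mem_range.1 hj).trans (Nat.lt_succ_self i)))
  cases act j
  · simp
  · simp [pow_sub₀ (2 : ℝ) two_ne_zero hle, mul_comm]

theorem requestCode_spec (i : ℕ) :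
    requestSum act len i * 2 ^ (len i + 1) ≤ requestCode act len i ∧
      requestCode act len i < requestSum act len i * 2 ^ (len i + 1) + 1 := by
  have hD : 0 < 2 ^ requestExponent len i := by positivity
  have hDR : (0 : ℝ) < 2 ^ requestExponent len i := by positivity
  have e := requestNumerator_eq (act := act) (len := len) i
  set D := requestExponent len i with hDdef
  set N := requestNumerator act len i
  have hk : requestCode act len i = (N * 2 ^ (len i + 1) + (2 ^ D - 1)) / 2 ^ D := rfl
  have h1 : N * 2 ^ (len i + 1) ≤ requestCode act len i * 2 ^ D := by
    have := Nat.lt_div_mul_add (a := N * 2 ^ (len i + 1) + (2 ^ D - 1)) hD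
    rw [← hk] at this
    omega
  have h2 : requestCode act len i * 2 ^ D < N * 2 ^ (len i + 1) + 2 ^ D := by
    have := Nat.div_mul_le_self (N * 2 ^ (len i + 1) + (2 ^ D - 1)) (2 ^ D)
    rw [← hk] at this
    omega
  have h1' : (N : ℝ) * 2 ^ (len i + 1) ≤ requestCode act len i * 2 ^ D := by exact_mod_cast h1
  have h2' : (requestCode act len i : ℝ) * 2 ^ D < N * 2 ^ (len i + 1) + 2 ^ D := by
    exact_mod_cast h2
  rw [e] at h1' h2'
  constructor
  · refine le_of_mul_le_mul_right ?_ hDR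
    linarith
  · refine lt_of_mul_lt_mul_right ?_ hDR.le
    linarith

/-- The dyadic interval of the strings that extend a program for the request `i` lies between
the partial sums `i` and `i + 1`. -/
theorem isRequestProgram_bounds {p : List Bool} {i : ℕ} (h : isRequestProgram act len p i = true)
    (t : List Bool) :
    requestSum act len i ≤ binaryValue (p ++ t) / 2 ^ (p ++ t).length ∧
      (binaryValue (p ++ t) : ℝ) / 2 ^ (p ++ t).length < requestSum act len (i + 1) := by
  simp only [isRequestProgram, Bool.and_eq_true, decide_eq_true_eq] at h
  obtain ⟨ha, hl, hv⟩ := h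
  obtain ⟨h1, h2⟩ := requestCode_spec (act := act) (len := len) i
  have ht : (binaryValue t : ℝ) < 2 ^ t.length := by exact_mod_cast binaryValue_lt t
  have ht0 : (0 : ℝ) < 2 ^ t.length := by positivity
  rw [requestSum_succ, if_pos ha, List.length_append, binaryValue_append, hv, hl, pow_add]
  push_cast
  constructor
  · rw [le_div_iff₀ (by positivity)]
    have := mul_le_mul_of_nonneg_right h1 ht0.le
    have h0 : (0 : ℝ) ≤ binaryValue t := Nat.cast_nonneg _
    linarith
  · rw [div_lt_iff₀ (by positivity)]
    have e : (1 / 2 : ℝ) ^ len i * (2 ^ (len i + 1) * 2 ^ t.length) = 2 * 2 ^ t.length := by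
      rw [pow_succ, one_div_pow]; field_simp
    have h3 := mul_lt_mul_of_pos_right h2 ht0
    rw [add_mul, e]
    linarith

theorem isRequestProgram_unique {p t : List Bool} {i j : ℕ}
    (hp : isRequestProgram act len p i = true)
    (hq : isRequestProgram act len (p ++ t) j = true) : i = j := by
  obtain ⟨h1, h2⟩ := isRequestProgram_bounds hp t
  obtain ⟨h3, h4⟩ := isRequestProgram_bounds hq []
  rw [List.append_nil] at h3 h4
  by_contra hne
  rcases Nat.lt_or_gt_of_ne hne with h | h
  · linarith [requestSum_mono (act := act) (len := len) (Nat.succ_le_of_lt h)]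
  · linarith [requestSum_mono (act := act) (len := len) (Nat.succ_le_of_lt h)]

theorem computable_isRequestProgram (ha : Computable act) (hl : Computable len) :
    Computable₂ (isRequestProgram act len) := by
  open Computable in
  have hE : Computable (requestExponent len) :=
    nat_sum_range (nat_add Computable.id (const 1)) (hl.comp snd).to₂
  have hN : Computable (requestNumerator act len) :=
    nat_sum_range Computable.id (Computable.to₂ (Computable.cond (ha.comp snd)
      (nat_pow (const 2) (nat_sub (hE.comp fst) (hl.comp snd))) (const 0)))
  have hD : Computable fun i => 2 ^ requestExponent len i := nat_pow (const 2) hE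
  have hC : Computable (requestCode act len) :=
    nat_div (nat_add (nat_mul hN (nat_pow (const 2) (nat_add hl (const 1))))
      (nat_sub hD (const 1))) hD
  exact band (ha.comp snd) (band
    (decide_nat_eq (list_length.comp fst) (nat_add (hl.comp snd) (const 1)))
    (decide_nat_eq (computable_binaryValue.comp fst) (hC.comp snd)))

/-- The Kraft–Chaitin theorem, with one extra bit: a computable list of requests of total weight
at most `1` is served by a prefix-free machine. -/
theorem exists_prefixFreeMachine_of_requests {out : ℕ → List Bool} (ha : Computable act)
    (hl : Computable len) (ho : Computable out) (hsum : ∀ i, requestSum act len i ≤ 1) :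
    ∃ M : List Bool →. List Bool, IsPrefixFreeMachine M ∧
      ∀ i, act i = true → ∃ p : List Bool, out i ∈ M p ∧ p.length = len i + 1 := by
  have hprog := computable_isRequestProgram ha hl
  have hM : Partrec fun p : List Bool =>
      (Nat.rfind fun i => Part.some (isRequestProgram act len p i)).map out :=
    (Partrec.rfind hprog.partrec₂).map (ho.comp Computable.snd).to₂
  have hdom : ∀ p, p ∈ PFun.Dom (fun p : List Bool =>
      (Nat.rfind fun i => Part.some (isRequestProgram act len p i)).map out) →
      ∃ i, isRequestProgram act len p i = true := by
    intro p hp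
    obtain ⟨n, hn, -⟩ := Nat.rfind_dom.1 hp
    exact ⟨n, by simpa using hn⟩
  refine ⟨_, ⟨hM, ?_⟩, ?_⟩
  · rintro p hp q hq ⟨t, rfl⟩
    obtain ⟨i, hi⟩ := hdom p hp
    obtain ⟨j, hj⟩ := hdom _ hq
    obtain rfl := isRequestProgram_unique hi hj
    simp only [isRequestProgram, Bool.and_eq_true, decide_eq_true_eq] at hi hj
    have := hj.2.1
    rw [List.length_append, hi.2.1] at this
    rw [List.eq_nil_of_length_eq_zero (by omega : t.length = 0), List.append_nil]
  · intro i hi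
    have hpow : (1 / 2 : ℝ) ^ len i * 2 ^ (len i + 1) = 2 := by
      rw [pow_succ, one_div_pow]; field_simp
    have hlt : requestCode act len i < 2 ^ (len i + 1) := by
      have h1 := (requestCode_spec (act := act) (len := len) i).2
      have h2 := hsum (i + 1)
      rw [requestSum_succ, if_pos hi] at h2
      have h3 := mul_le_mul_of_nonneg_right h2 (by positivity : (0 : ℝ) ≤ 2 ^ (len i + 1))
      rw [add_mul, hpow, one_mul] at h3
      have : (requestCode act len i : ℝ) < 2 ^ (len i + 1) := by linarith
      exact_mod_cast this
    obtain ⟨p, hp, hv⟩ := exists_binaryValue_eq _ _ hlt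
    have hreq : isRequestProgram act len p i = true := by
      simp [isRequestProgram, hi, hp, hv]
    refine ⟨p, ?_, hp⟩
    obtain ⟨j, hj, -⟩ := Nat.rfind_min' (p := isRequestProgram act len p) hreq
    have hj' : isRequestProgram act len p j = true := by
      simpa using (Nat.rfind_spec hj)
    have hij : i = j := isRequestProgram_unique (t := []) hreq (by rwa [List.append_nil])
    rw [hij]
    exact Part.mem_map out hj

end Requests

/-! ### Counting the changes of the leading bits along an increasing sequence -/

/-- One step of a monotone sequence: if the integer part changes in a small step, then the
fractional part drops, and only the length of the step has to be paid for. -/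
theorem floor_change_add_fract_sub_le {x y : ℝ} (h : x ≤ y) :
    (if ⌊x⌋ = ⌊y⌋ then (0 : ℝ) else 1) + Int.fract y - Int.fract x ≤ 2 * min (y - x) 1 := by
  have ex := Int.floor_add_fract x
  have ey := Int.floor_add_fract y
  have hx0 := Int.fract_nonneg x
  have hx1 := Int.fract_lt_one x
  have hy0 := Int.fract_nonneg y
  have hy1 := Int.fract_lt_one y
  split_ifs with hf
  · rw [hf] at ex
    rw [min_eq_left (by linarith)]
    linarith
  · have hlt : (⌊x⌋ : ℝ) + 1 ≤ ⌊y⌋ := by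
      exact_mod_cast Int.add_one_le_of_lt (lt_of_le_of_ne (Int.floor_mono h) hf)
    rcases min_cases (y - x) 1 with ⟨e, _⟩ | ⟨e, _⟩ <;> rw [e] <;> linarith

theorem sum_floor_change_le {b : ℕ → ℝ} (hb : Monotone b) (hb0 : b 0 = 0) (N : ℕ) :
    ∑ s ∈ Finset.range N, (if ⌊b s⌋ = ⌊b (s + 1)⌋ then (0 : ℝ) else 1) ≤
      2 * ∑ s ∈ Finset.range N, min (b (s + 1) - b s) 1 := by
  have key : ∀ N, ∑ s ∈ Finset.range N, (if ⌊b s⌋ = ⌊b (s + 1)⌋ then (0 : ℝ) else 1) +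
      Int.fract (b N) ≤ 2 * ∑ s ∈ Finset.range N, min (b (s + 1) - b s) 1 := by
    intro N
    induction N with
    | zero => simp [hb0]
    | succ N ih =>
      rw [Finset.sum_range_succ, Finset.sum_range_succ]
      linarith [floor_change_add_fract_sub_le (hb (Nat.le_succ N))]
  linarith [key N, Int.fract_nonneg (b N)]

/-- For `0 < T < 1` the sum over all levels `n` of `2 ^ (-T n) * min (2 ^ n δ) 1` is at most a
constant times `δ ^ T`: it is dominated by the levels with `2 ^ n δ` close to `1`. -/
theorem exists_sum_level_le {T : ℝ} (hT0 : 0 < T) (hT1 : T < 1) :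
    ∃ C : ℝ, 0 ≤ C ∧ ∀ (N : ℕ) (δ : ℝ), 0 ≤ δ →
      ∑ n ∈ Finset.range N, ((2 : ℝ) ^ (-T)) ^ n * min (2 ^ n * δ) 1 ≤ C * δ ^ T := by
  set q : ℝ := (2 : ℝ) ^ (-T) with hq
  have hq0 : 0 < q := by positivity
  have hq1 : q < 1 := Real.rpow_lt_one_of_one_lt_of_neg one_lt_two (by linarith)
  have hq2 : 1 < 2 * q := by
    have : (2 : ℝ) * q = 2 ^ (1 - T) := by
      rw [hq, sub_eq_add_neg, Real.rpow_add two_pos, Real.rpow_one]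
    rw [this]
    exact Real.one_lt_rpow one_lt_two (by linarith)
  have hqT : q * 2 ^ T = 1 := by
    rw [hq, ← Real.rpow_add two_pos, neg_add_cancel, Real.rpow_zero]
  set B : ℝ := (1 - q)⁻¹ with hB
  have hB0 : 0 < B := inv_pos.2 (by linarith)
  have hbound : ∀ (N : ℕ) (δ : ℝ), ∑ n ∈ Finset.range N, q ^ n * min (2 ^ n * δ) 1 ≤ B := by
    intro N δ
    calc ∑ n ∈ Finset.range N, q ^ n * min (2 ^ n * δ) 1
        ≤ ∑ n ∈ Finset.range N, q ^ n := Finset.sum_le_sum fun n _ =>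
          mul_le_of_le_one_right (by positivity) (min_le_right _ _)
      _ ≤ ∑' n, q ^ n := (summable_geometric_of_lt_one hq0.le hq1).sum_le_tsum _
          fun n _ => by positivity
      _ = B := tsum_geometric_of_lt_one hq0.le hq1
  -- `D` solves `δ + q * (-D * (2 * δ)) = -D * δ`, the linear part of the recursion below.
  set D : ℝ := (2 * q - 1)⁻¹ with hD
  have hD0 : 0 < D := inv_pos.2 (by linarith)
  have hDq : D * (2 * q - 1) = 1 := inv_mul_cancel₀ (by linarith)
  set C : ℝ := (B + D) * 2 ^ T with hC
  have hC0 : 0 ≤ C := by positivity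
  have hsmall : ∀ (N : ℕ) (δ : ℝ), 0 ≤ δ → δ ≤ 1 →
      ∑ n ∈ Finset.range N, q ^ n * min (2 ^ n * δ) 1 ≤ C * δ ^ T - D * δ := by
    intro N
    induction N with
    | zero =>
      intro δ h0 h1
      have h2 : δ ≤ δ ^ T := by
        simpa using Real.rpow_le_rpow_of_exponent_ge' h0 h1 hT0.le hT1.le
      have h3 : D ≤ C := by
        have : (1 : ℝ) ≤ 2 ^ T := Real.one_le_rpow one_le_two hT0.le
        rw [hC]; nlinarith
      simp only [Finset.range_zero, Finset.sum_empty]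
      have := mul_le_mul h3 h2 h0 hC0
      linarith
    | succ N ih =>
      intro δ h0 h1
      rcases le_total δ (1 / 2) with h | h
      · have hs := ih (2 * δ) (by linarith) (by linarith)
        rw [Finset.sum_range_succ']
        have e : ∀ n, q ^ (n + 1) * min (2 ^ (n + 1) * δ) 1 =
            q * (q ^ n * min (2 ^ n * (2 * δ)) 1) := by
          intro n
          rw [pow_succ, pow_succ, mul_assoc (2 ^ n : ℝ) 2 δ]
          ring
        simp only [e]
        rw [← Finset.mul_sum]
        have h2 := mul_le_mul_of_nonneg_left hs hq0.le
        have h3 : q * (C * (2 * δ) ^ T - D * (2 * δ)) = C * δ ^ T - δ - D * δ := by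
          rw [Real.mul_rpow two_pos.le h0]
          linear_combination (C * δ ^ T) * hqT - δ * hDq
        simp only [pow_zero, one_mul]
        linarith [min_le_left δ 1]
      · have h2 : (1 / 2 : ℝ) ^ T ≤ δ ^ T := Real.rpow_le_rpow (by norm_num) h hT0.le
        have h3 : (2 : ℝ) ^ T * (1 / 2) ^ T = 1 := by
          rw [← Real.mul_rpow (by norm_num) (by norm_num)]; norm_num
        have h4 : B + D ≤ C * δ ^ T := by
          calc B + D = C * (1 / 2) ^ T := by rw [hC, mul_assoc, h3, mul_one]
            _ ≤ C * δ ^ T := mul_le_mul_of_nonneg_left h2 hC0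
        have h5 : D * δ ≤ D := mul_le_of_le_one_right hD0.le h1
        linarith [hbound (N + 1) δ]
  refine ⟨C, hC0, fun N δ h0 => ?_⟩
  rcases le_total δ 1 with h1 | h1
  · linarith [hsmall N δ h0 h1, mul_nonneg hD0.le h0]
  · have h2 : B ≤ C := by
      have : (1 : ℝ) ≤ 2 ^ T := Real.one_le_rpow one_le_two hT0.le
      rw [hC]; nlinarith
    have h3 : (1 : ℝ) ≤ δ ^ T := Real.one_le_rpow h1 hT0.le
    have := mul_le_mul_of_nonneg_left h3 hC0
    linarith [hbound N δ]

/-- If the increments of an increasing sequence have a bounded sum of `T`-th powers, then the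
changes of the first `n` bits, weighted with `2 ^ (-T n)` and summed over all `n`, have a bounded
sum. -/
theorem exists_sum_floor_change_le {T : ℝ} (hT0 : 0 < T) (hT1 : T < 1) {a : ℕ → ℝ}
    (ha : Monotone a) (ha0 : a 0 = 0) {K : ℝ}
    (hK : ∀ N, ∑ s ∈ Finset.range N, (a (s + 1) - a s) ^ T ≤ K) :
    ∃ C : ℝ, ∀ N N' : ℕ, ∑ s ∈ Finset.range N, ∑ n ∈ Finset.range N',
      (if ⌊2 ^ n * a s⌋ = ⌊2 ^ n * a (s + 1)⌋ then 0 else ((2 : ℝ) ^ (-T)) ^ n) ≤ C := by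
  obtain ⟨C, hC0, hC⟩ := exists_sum_level_le hT0 hT1
  refine ⟨2 * (C * K), fun N N' => ?_⟩
  rw [Finset.sum_comm]
  calc ∑ n ∈ Finset.range N', ∑ s ∈ Finset.range N,
        (if ⌊2 ^ n * a s⌋ = ⌊2 ^ n * a (s + 1)⌋ then 0 else ((2 : ℝ) ^ (-T)) ^ n)
      ≤ ∑ n ∈ Finset.range N', ((2 : ℝ) ^ (-T)) ^ n *
          (2 * ∑ s ∈ Finset.range N, min (2 ^ n * (a (s + 1) - a s)) 1) := by
        refine Finset.sum_le_sum fun n _ => ?_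
        have h := sum_floor_change_le (b := fun s => 2 ^ n * a s)
          (fun s t hst => mul_le_mul_of_nonneg_left (ha hst) (by positivity)) (by simp [ha0]) N
        simp only [← mul_sub] at h
        refine le_trans (le_of_eq ?_) (mul_le_mul_of_nonneg_left h (by positivity))
        rw [Finset.mul_sum]
        refine Finset.sum_congr rfl fun s _ => ?_
        split_ifs <;> simp
    _ = 2 * ∑ s ∈ Finset.range N, ∑ n ∈ Finset.range N',
          ((2 : ℝ) ^ (-T)) ^ n * min (2 ^ n * (a (s + 1) - a s)) 1 := by
        rw [Finset.sum_comm, Finset.mul_sum]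
        refine Finset.sum_congr rfl fun n _ => ?_
        rw [← Finset.mul_sum]
        ring
    _ ≤ 2 * ∑ s ∈ Finset.range N, C * (a (s + 1) - a s) ^ T := by
        gcongr with s _
        exact hC N' _ (sub_nonneg.2 (ha (Nat.le_succ s)))
    _ ≤ 2 * (C * K) := by
        rw [← Finset.mul_sum]
        gcongr
        exact hK N

/-! ### Predicting a sequence without long runs of zeros -/

/-- Transition function of the automaton that ignores the first `N` bits and then counts
consecutive zeros up to `k`. The state `s ≤ N` means that `s` bits have been ignored, and the state
`N + j` that the last `j` bits were zeros. -/
def runStep (N k s : ℕ) (x : Bool) : ℕ :=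
  if s < N then s + 1 else if x then N else min (s + 1) (N + k)

theorem runStep_lt {N k s : ℕ} (x : Bool) : runStep N k s x < N + k + 1 := by
  unfold runStep
  split_ifs <;> omega

/-- The automaton with transition function `runStep` that predicts `b` after `k` zeros. -/
def runAutomaton (N k : ℕ) (b : Bool) : OutputAutomaton (Fin (N + k + 1)) Bool (Option Bool) where
  step s x := ⟨runStep N k s x, runStep_lt x⟩
  start := 0
  out s := if (s : ℕ) = N + k then some b else none

theorem bitPrefix_succ (X : ℕ → Bool) (n : ℕ) : bitPrefix X (n + 1) = bitPrefix X n ++ [X n] := by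
  simp [bitPrefix, List.range_succ]

theorem runAutomaton_state_spec (N k : ℕ) (b : Bool) (X : ℕ → Bool) (n : ℕ) :
    letI M := runAutomaton N k b
    letI s : ℕ := ((bitPrefix X n).foldl M.step M.start : Fin (N + k + 1))
    (n < N → s = n) ∧
      (N ≤ n → ∃ m j, n = m + j ∧ N ≤ m ∧ s = N + j ∧ j ≤ k ∧ (∀ i < j, X (m + i) = false) ∧
        (j = k ∨ m = N ∨ X (m - 1) = true)) := by
  induction n with
  | zero =>
    refine ⟨fun _ => rfl, fun h => ⟨0, 0, rfl, h, ?_, k.zero_le, by simp, ?_⟩⟩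
    · obtain rfl : N = 0 := by omega
      rfl
    · exact Or.inr (Or.inl (by omega))
  | succ n ih =>
    obtain ⟨h1, h2⟩ := ih
    rw [bitPrefix_succ, List.foldl_append]
    generalize (bitPrefix X n).foldl (runAutomaton N k b).step (runAutomaton N k b).start = s
      at h1 h2
    change (_ → runStep N k s (X n) = _) ∧ (_ → ∃ m j, _ ∧ _ ∧ runStep N k s (X n) = _ ∧ _)
    rcases lt_or_ge n N with hn | hn
    · have hs := h1 hn
      have e : runStep N k s (X n) = n + 1 := by
        unfold runStep
        rw [if_pos (by omega), hs]
      rw [e]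
      exact ⟨fun _ => rfl, fun h => ⟨n + 1, 0, rfl, h, by omega, k.zero_le, by simp,
        Or.inr (Or.inl (by omega))⟩⟩
    · refine ⟨fun h => absurd h (by omega), fun _ => ?_⟩
      obtain ⟨m, j, hmj, hm, hs, hjk, hrun, hmax⟩ := h2 hn
      have e : runStep N k s (X n) = if X n then N else min (N + j + 1) (N + k) := by
        unfold runStep
        rw [if_neg (by omega), hs]
      rw [e]
      cases hX : X n
      · simp only [Bool.false_eq_true, if_false]
        rcases hjk.lt_or_eq with hlt | rfl
        · refine ⟨m, j + 1, by omega, hm, by omega, hlt, fun i hi => ?_, ?_⟩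
          · rcases Nat.lt_succ_iff_lt_or_eq.1 hi with h | rfl
            · exact hrun i h
            · rw [← hmj, hX]
          · rcases hmax with h | h
            · omega
            · exact Or.inr h
        · refine ⟨m + 1, j, by omega, by omega, by omega, le_rfl, fun i hi => ?_, Or.inl rfl⟩
          rcases lt_or_ge (i + 1) j with h | h
          · rw [add_assoc, add_comm 1 i]
            exact hrun _ h
          · rw [show m + 1 + i = n by omega, hX]
      · simp only [if_true]
        exact ⟨n + 1, 0, rfl, by omega, rfl, k.zero_le, by simp, Or.inr (Or.inr hX)⟩

/-- If, from some position on, every block of `k` zeros is followed by `b`, and there are infinitely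
many such blocks, then the sequence is predictable. -/
theorem finiteStateStronglyPredictable_of_run {X : ℕ → Bool} {k N : ℕ} {b : Bool}
    (hb : ∀ n ≥ N, (∀ i < k, X (n + i) = false) → X (n + k) = b)
    (hinf : ∀ n₀, ∃ n ≥ n₀, ∀ i < k, X (n + i) = false) :
    FiniteStateStronglyPredictable X := by
  refine ⟨Fin (N + k + 1), inferInstance, runAutomaton N k b, fun n hn => ?_, ?_⟩
  · obtain ⟨h1, h2⟩ := runAutomaton_state_spec N k b X n
    unfold OutputAutomaton.output at hn ⊢
    generalize (bitPrefix X n).foldl (runAutomaton N k b).step (runAutomaton N k b).start = s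
      at h1 h2 hn ⊢
    have hs : (s : ℕ) = N + k := by
      by_contra h
      exact hn (if_neg h)
    rcases lt_or_ge n N with h | h
    · have := h1 h
      omega
    · obtain ⟨m, j, rfl, hm, hj, -, hrun, -⟩ := h2 h
      obtain rfl : j = k := by omega
      rw [hb m hm hrun]
      exact if_pos hs
  · refine Set.infinite_of_forall_exists_gt fun n₀ => ?_
    obtain ⟨n, hn, hrun⟩ := hinf (N + n₀ + 1)
    refine ⟨n + k, ?_, by omega⟩
    obtain ⟨-, h2⟩ := runAutomaton_state_spec N k b X (n + k)
    obtain ⟨m, j, hmj, hm, hs, hjk, -, hmax⟩ := h2 (by omega)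
    have hj : j = k := by
      by_contra hne
      rcases hmax with h | h | h
      · exact hne h
      · omega
      · have := hrun (m - 1 - n) (by omega)
        rw [show n + (m - 1 - n) = m - 1 by omega, h] at this
        simp at this
    rw [hj] at hs
    have : (runAutomaton N k b).output (bitPrefix X (n + k)) = some b := if_pos hs
    change (runAutomaton N k b).output (bitPrefix X (n + k)) ≠ none
    rw [this]
    simp

/-- A sequence in which blocks of `m` zeros do not occur from some position on is predictable: if
`k` is maximal such that infinitely many blocks of `k` zeros occur, then almost all of these are
followed by a one. -/
theorem finiteStateStronglyPredictable_of_no_run {X : ℕ → Bool} {m N : ℕ}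
    (h : ∀ n ≥ N, ∃ i < m, X (n + i) = true) : FiniteStateStronglyPredictable X := by
  classical
  have hex : ∃ m, ∃ N, ∀ n ≥ N, ∃ i < m, X (n + i) = true := ⟨m, N, h⟩
  obtain ⟨k, hk⟩ : ∃ k, Nat.find hex = k + 1 := by
    refine Nat.exists_eq_succ_of_ne_zero fun h0 => ?_
    obtain ⟨N, hN⟩ := Nat.find_spec hex
    obtain ⟨i, hi, -⟩ := hN N le_rfl
    omega
  obtain ⟨N, hN⟩ := Nat.find_spec hex
  rw [hk] at hN
  refine finiteStateStronglyPredictable_of_run (k := k) (N := N) (b := true) ?_ ?_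
  · intro n hn hrun
    obtain ⟨i, hi, hXi⟩ := hN n hn
    rcases Nat.lt_succ_iff_lt_or_eq.1 hi with h | rfl
    · rw [hrun i h] at hXi
      simp at hXi
    · exact hXi
  · have := Nat.find_min hex (m := k) (by omega)
    push Not at this
    simpa using this

theorem pow_mul_fract_lt_one_of_run {α : ℝ} {m n : ℕ}
    (h : ∀ i < m, baseTwoExpansion α (n + i) = false) :
    (2 : ℝ) ^ m * Int.fract (2 ^ n * Int.fract α) < 1 := by
  have key : ∀ j ≤ m,
      ⌊(2 : ℝ) ^ (n + j) * Int.fract α⌋ = 2 ^ j * ⌊(2 : ℝ) ^ n * Int.fract α⌋ := by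
    intro j
    induction j with
    | zero => simp
    | succ j ih =>
      intro hj
      have hbit := h j hj
      simp only [baseTwoExpansion, decide_eq_false_iff_not] at hbit
      have h2 := floor_pow_succ_mul (Int.fract α) (n + j)
      rw [if_neg hbit, ih (by omega)] at h2
      rw [← add_assoc, h2]
      ring
  have h1 := Int.lt_floor_add_one ((2 : ℝ) ^ (n + m) * Int.fract α)
  rw [key m le_rfl] at h1
  push_cast at h1
  rw [pow_add] at h1
  unfold Int.fract at h1 ⊢
  linarith

theorem baseTwoExpansion_eq_false_of_fract_eq_zero {α : ℝ} {n : ℕ}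
    (h : Int.fract (2 ^ n * Int.fract α) = 0) (i : ℕ) : baseTwoExpansion α (n + i) = false := by
  have e := Int.floor_add_fract ((2 : ℝ) ^ n * Int.fract α)
  rw [h, add_zero] at e
  have e2 : (2 : ℝ) ^ (n + i + 1) * Int.fract α =
      ((2 * (2 ^ i * ⌊(2 : ℝ) ^ n * Int.fract α⌋) : ℤ) : ℝ) := by
    push_cast
    rw [e]
    ring
  simp only [baseTwoExpansion, decide_eq_false_iff_not]
  rw [e2, Int.floor_intCast]
  omega

theorem fract_pow_mul_fract (α : ℝ) (n : ℕ) :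
    Int.fract (2 ^ n * Int.fract α) = Int.fract (2 ^ n * α) := by
  have e : (2 : ℝ) ^ n * Int.fract α = 2 ^ n * α - ((2 ^ n * ⌊α⌋ : ℤ) : ℝ) := by
    unfold Int.fract
    push_cast
    ring
  rw [e, Int.fract_sub_intCast]

/-- The expansion of `α` is predictable if the tails of the expansion are zero or bounded away from
zero. -/
theorem finiteStateStronglyPredictable_of_le_fract {α : ℝ} {m N : ℕ}
    (h : ∀ n ≥ N, 0 < Int.fract (2 ^ n * α) → 1 ≤ 2 ^ m * Int.fract (2 ^ n * α)) :
    FiniteStateStronglyPredictable (baseTwoExpansion α) := by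
  by_cases hz : ∃ n ≥ N, Int.fract (2 ^ n * α) = 0
  · obtain ⟨n, -, hn⟩ := hz
    rw [← fract_pow_mul_fract] at hn
    refine finiteStateStronglyPredictable_of_run (k := 0) (N := n) (b := false) ?_ ?_
    · intro l hl _
      obtain ⟨i, rfl⟩ := Nat.exists_eq_add_of_le hl
      exact baseTwoExpansion_eq_false_of_fract_eq_zero hn i
    · exact fun n₀ => ⟨n₀, le_rfl, by simp⟩
  · push Not at hz
    refine finiteStateStronglyPredictable_of_no_run (m := m) (N := N) fun n hn => ?_
    by_contra hc
    push Not at hc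
    have h1 := pow_mul_fract_lt_one_of_run (α := α) (m := m) (n := n)
      (fun i hi => by simpa using hc i hi)
    rw [fract_pow_mul_fract] at h1
    exact absurd (h n hn (lt_of_le_of_ne (Int.fract_nonneg _) (hz n hn).symm)) (not_le.2 h1)

/-! ### Enumerating the domain of a machine -/

/-- The string with code `n`, and the empty string if there is none. -/
def stringOfNat (n : ℕ) : List Bool := (Encodable.decode n).getD []

theorem stringOfNat_encode (p : List Bool) : stringOfNat (Encodable.encode p) = p := by
  simp [stringOfNat]

theorem computable_stringOfNat : Computable stringOfNat :=
  Computable.option_getD Computable.decode (Computable.const [])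

/-- The domain of a partial computable function on strings is the union of an increasing sequence of
finite sets `H s`, along which sums can be computed, together with a computable sequence of strings
`out s` that are not among the values on `H s`. -/
theorem exists_stages {U : List Bool →. List Bool} (hU : Partrec U) :
    ∃ H : ℕ → Finset (List Bool), ∃ out : ℕ → List Bool,
      H 0 = ∅ ∧ Monotone H ∧ (∀ s, (H s).card ≤ s) ∧ (∀ p, p ∈ U.Dom ↔ ∃ s, p ∈ H s) ∧
      (∀ F : ℕ → List Bool → ℕ, Computable₂ F → Computable fun s => ∑ p ∈ H s, F s p) ∧
      Computable out ∧ ∀ s, ∀ p ∈ H s, out s ∉ U p := by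
  classical
  obtain ⟨c, hc⟩ := Nat.Partrec.Code.exists_code.1 hU
  let h : ℕ → ℕ → Bool := fun s n =>
    (Nat.Partrec.Code.evaln s c n).isSome && decide (Encodable.encode (stringOfNat n) = n)
  have hh : ∀ s n, h s n = true ↔
      (Nat.Partrec.Code.evaln s c n).isSome = true ∧ Encodable.encode (stringOfNat n) = n := by
    intro s n
    simp [h]
  let H : ℕ → Finset (List Bool) := fun s =>
    ((Finset.range s).filter fun n => h s n = true).image stringOfNat
  have hmem : ∀ s p, p ∈ H s ↔
      ∃ y, y ∈ Nat.Partrec.Code.evaln s c (Encodable.encode p) := by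
    intro s p
    simp only [H, Finset.mem_image, Finset.mem_filter, Finset.mem_range, hh]
    constructor
    · rintro ⟨n, ⟨-, h1, h2⟩, rfl⟩
      rw [h2]
      exact Option.isSome_iff_exists.1 h1
    · rintro ⟨y, hy⟩
      exact ⟨Encodable.encode p, ⟨Nat.Partrec.Code.evaln_bound hy,
        Option.isSome_iff_exists.2 ⟨y, hy⟩, by rw [stringOfNat_encode]⟩, stringOfNat_encode p⟩
  have heval : ∀ p, Nat.Partrec.Code.eval c (Encodable.encode p) =
      (U p).map Encodable.encode := by
    intro p
    rw [hc]
    simp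
  have hevaln : Computable₂ fun s n => Nat.Partrec.Code.evaln s c n :=
    Nat.Partrec.Code.primrec_evaln.to_comp.comp
      ((Computable.fst.pair (Computable.const c)).pair Computable.snd)
  have hcomp : Computable₂ h :=
    Computable.band (Primrec.option_isSome.to_comp.comp hevaln)
      (Computable.decide_nat_eq
        (Computable.encode.comp (computable_stringOfNat.comp Computable.snd)) Computable.snd)
  let len : ℕ → ℕ := fun s => ∑ n ∈ Finset.range s,
    (stringOfNat ((Nat.Partrec.Code.evaln s c n).getD 0)).length
  have hlen : Computable len :=
    Computable.nat_sum_range Computable.id (Computable.list_length.comp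
      (computable_stringOfNat.comp (Computable.option_getD hevaln (Computable.const 0))))
  refine ⟨H, fun s => (List.range (len s + 1)).map fun _ => true, rfl, ?_, ?_, ?_, ?_, ?_, ?_⟩
  · intro s t hst p hp
    rw [hmem] at hp ⊢
    obtain ⟨y, hy⟩ := hp
    exact ⟨y, Nat.Partrec.Code.evaln_mono hst hy⟩
  · intro s
    exact Finset.card_image_le.trans ((Finset.card_filter_le _ _).trans (Finset.card_range s).le)
  · intro p
    simp only [hmem]
    constructor
    · intro hp
      have hy : Encodable.encode ((U p).get hp) ∈ Nat.Partrec.Code.eval c (Encodable.encode p) := by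
        rw [heval]
        exact Part.mem_map _ (Part.get_mem hp)
      obtain ⟨k, hk⟩ := Nat.Partrec.Code.evaln_complete.1 hy
      exact ⟨k, _, hk⟩
    · rintro ⟨s, y, hy⟩
      have := Nat.Partrec.Code.evaln_sound hy
      rw [heval] at this
      obtain ⟨x, hx, -⟩ := (Part.mem_map_iff _).1 this
      exact Part.dom_iff_mem.2 ⟨x, hx⟩
  · intro F hF
    have hc : Computable fun s => ∑ n ∈ Finset.range s, bif h s n then F s (stringOfNat n) else 0 :=
      Computable.nat_sum_range Computable.id (Computable.cond hcomp
        (hF.comp Computable.fst (computable_stringOfNat.comp Computable.snd)) (Computable.const 0))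
    refine hc.of_eq fun s => ?_
    simp only [H]
    rw [Finset.sum_image, Finset.sum_filter]
    · refine Finset.sum_congr rfl fun n _ => ?_
      cases h s n <;> simp
    · intro m hm n hn hmn
      have hm' := ((hh s m).1 (Finset.mem_filter.1 hm).2).2
      have hn' := ((hh s n).1 (Finset.mem_filter.1 hn).2).2
      rw [← hm', ← hn']
      exact congrArg _ hmn
  · exact (Primrec.list_map Primrec.list_range (Primrec.const true).to₂).to_comp.comp
      (Computable.nat_add hlen (Computable.const 1))
  · intro s p hp hx
    obtain ⟨y, hy⟩ := (hmem s p).1 hp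
    have h1 := Nat.Partrec.Code.evaln_sound hy
    rw [heval] at h1
    obtain rfl := Part.mem_unique h1 (Part.mem_map Encodable.encode hx)
    have h2 : (stringOfNat ((Nat.Partrec.Code.evaln s c (Encodable.encode p)).getD 0)).length ≤
        len s :=
      Finset.single_le_sum
        (f := fun n => (stringOfNat ((Nat.Partrec.Code.evaln s c n).getD 0)).length)
        (fun _ _ => Nat.zero_le _) (Finset.mem_range.2 (Nat.Partrec.Code.evaln_bound hy))
    rw [Option.mem_def.1 hy, Option.getD_some, stringOfNat_encode] at h2
    simp at h2

/-! ### Kraft's inequality -/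

theorem PrefixFree.uniquelyDecodable {S : Set (List Bool)} (hS : PrefixFree S) (h0 : [] ∉ S) :
    InformationTheory.UniquelyDecodable S := by
  intro L₁
  induction L₁ with
  | nil =>
    intro L₂ _ h2 he
    cases L₂ with
    | nil => rfl
    | cons q L₂ =>
      have hq : q = [] := by
        have := he.symm
        simp only [List.flatten_nil, List.flatten_cons, List.append_eq_nil_iff] at this
        exact this.1
      exact absurd (hq ▸ h2 q List.mem_cons_self) h0
  | cons p L₁ ih =>
    intro L₂ h1 h2 he
    cases L₂ with
    | nil =>
      have hp : p = [] := by
        simp only [List.flatten_nil, List.flatten_cons, List.append_eq_nil_iff] at he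
        exact he.1
      exact absurd (hp ▸ h1 p List.mem_cons_self) h0
    | cons q L₂ =>
      have hp := h1 p List.mem_cons_self
      have hq := h2 q List.mem_cons_self
      rw [List.flatten_cons, List.flatten_cons] at he
      have hpq : p = q := by
        rcases List.prefix_or_prefix_of_prefix (List.prefix_append p L₁.flatten)
          (he ▸ List.prefix_append q L₂.flatten) with h | h
        · exact hS p hp q hq h
        · exact (hS q hq p hp h).symm
      subst hpq
      rw [ih L₂ (fun w hw => h1 w (List.mem_cons_of_mem _ hw))
        (fun w hw => h2 w (List.mem_cons_of_mem _ hw)) (List.append_cancel_left he)]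

theorem PrefixFree.sum_le_one {S : Set (List Bool)} (hS : PrefixFree S) {F : Finset (List Bool)}
    (hF : ∀ p ∈ F, p ∈ S) : ∑ p ∈ F, (1 / 2 : ℝ) ^ p.length ≤ 1 := by
  have hF' : PrefixFree (F : Set (List Bool)) := fun p hp q hq h => hS p (hF p hp) q (hF q hq) h
  by_cases h0 : [] ∈ F
  · have : F = {[]} := by
      refine Finset.eq_singleton_iff_unique_mem.2 ⟨h0, fun p hp => ?_⟩
      exact (hF' [] h0 p hp List.nil_prefix).symm
    simp [this]
  · simpa using InformationTheory.kraft_mcmillan_inequality (hF'.uniquelyDecodable h0)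

/-! ### Approximating the temperature and the weights -/

/-- A computable positive real is the limit of a computable increasing sequence of positive rationals
`u s / 4 ^ (s + c)` that approximate it from below. -/
theorem IsComputableReal.exists_lower_approx {T : ℝ} (hT : IsComputableReal T) (hT0 : 0 < T) :
    ∃ (c : ℕ) (u : ℕ → ℕ), Computable u ∧ Monotone (fun s => (u s : ℝ) / 4 ^ (s + c)) ∧
      ∀ s, (u s : ℝ) / 4 ^ (s + c) ≤ T ∧ T - u s / 4 ^ (s + c) ≤ T / 2 * (1 / 4) ^ s := by
  obtain ⟨f, hnum, hden, hf⟩ := hT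
  let b : ℕ → ℕ := fun s => 4 ^ s * (f (2 * s)).num.toNat / (f (2 * s)).den
  have hb : ∀ s, (4 : ℝ) ^ s * T - 2 < b s ∧ (b s : ℝ) ≤ 4 ^ s * T + 1 := by
    intro s
    have h4 : (0 : ℝ) < 4 ^ s := by positivity
    have h1 := hf (2 * s)
    rw [pow_mul, show ((1 / 2 : ℝ) ^ 2) = 1 / 4 by norm_num, one_div_pow, abs_lt] at h1
    have e1 : (4 : ℝ) ^ s * (1 / 4 ^ s) = 1 := by field_simp
    have hd : (0 : ℝ) < (f (2 * s)).den := by exact_mod_cast (f (2 * s)).den_pos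
    -- The nonnegative rational `g` is the positive part of `f (2 * s)`.
    set g : ℝ := ((f (2 * s)).num.toNat : ℝ) / (f (2 * s)).den with hg
    have hgf : ((f (2 * s) : ℚ) : ℝ) ≤ g ∧ (g ≤ f (2 * s) ∨ g = 0) := by
      rw [Rat.cast_def, hg]
      rcases le_total 0 (f (2 * s)).num with h | h
      · have : (((f (2 * s)).num.toNat : ℕ) : ℝ) = ((f (2 * s)).num : ℝ) := by
          exact_mod_cast Int.toNat_of_nonneg h
        rw [this]
        exact ⟨le_rfl, Or.inl le_rfl⟩
      · rw [Int.toNat_of_nonpos h]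
        refine ⟨?_, Or.inr (by simp)⟩
        gcongr
        exact_mod_cast h
    have hg1 : 4 ^ s * T - 1 < 4 ^ s * g := by
      have := mul_lt_mul_of_pos_left h1.2 h4
      have := mul_le_mul_of_nonneg_left hgf.1 h4.le
      linarith
    have hg2 : 4 ^ s * g ≤ 4 ^ s * T + 1 := by
      rcases hgf.2 with h | h
      · have := mul_lt_mul_of_pos_left h1.1 h4
        have := mul_le_mul_of_nonneg_left h h4.le
        linarith
      · rw [h]
        have := mul_pos h4 hT0
        linarith
    have hfloor : b s = ⌊4 ^ s * g⌋₊ := by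
      rw [hg, ← mul_div_assoc]
      have := Nat.floor_div_eq_div (K := ℝ) (4 ^ s * (f (2 * s)).num.toNat) (f (2 * s)).den
      push_cast at this
      rw [this]
    have hg0 : 0 ≤ 4 ^ s * g := by positivity
    have h2 := Nat.floor_le hg0
    have h3 := Nat.lt_floor_add_one (4 ^ s * g)
    rw [← hfloor] at h2 h3
    constructor <;> linarith
  -- The gap of `2` makes the approximations increase: the errors shrink by the factor `4`.
  have hsub : ∀ s, (4 : ℝ) ^ s * T - 4 ≤ (b s - 2 : ℕ) ∧
      ((b s - 2 : ℕ) = (0 : ℝ) ∨ ((b s - 2 : ℕ) : ℝ) ≤ 4 ^ s * T - 1) := by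
    intro s
    obtain ⟨h1, h2⟩ := hb s
    rcases le_total (b s) 2 with h | h
    · have h' : (b s : ℝ) ≤ 2 := by exact_mod_cast h
      rw [Nat.sub_eq_zero_of_le h]
      exact ⟨by push_cast; linarith, Or.inl (by simp)⟩
    · rw [Nat.cast_sub h]
      exact ⟨by push_cast; linarith, Or.inr (by push_cast; linarith)⟩
  have hmono : Monotone fun s => ((b s - 2 : ℕ) : ℝ) / 4 ^ s := by
    refine monotone_nat_of_le_succ fun s => ?_
    rw [div_le_div_iff₀ (by positivity) (by positivity), pow_succ]
    have h4 : (0 : ℝ) < 4 ^ s := by positivity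
    have h1 : ((b s - 2 : ℕ) : ℝ) * 4 ≤ (b (s + 1) - 2 : ℕ) := by
      rcases (hsub s).2 with h | h
      · rw [h, zero_mul]
        positivity
      · have := (hsub (s + 1)).1
        rw [pow_succ] at this
        linarith
    have := mul_le_mul_of_nonneg_right h1 h4.le
    linarith
  obtain ⟨c, hc⟩ := exists_pow_lt_of_lt_one (show 0 < T / 8 by linarith)
    (show (1 / 4 : ℝ) < 1 by norm_num)
  refine ⟨c, fun s => b (s + c) - 2, ?_, fun s t hst => hmono (by omega), fun s => ⟨?_, ?_⟩⟩
  · have h2 : Computable fun s : ℕ => 2 * (s + c) := Computable.nat_mul (Computable.const 2)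
      (Computable.nat_add Computable.id (Computable.const c))
    exact Computable.nat_sub (Computable.nat_div
      (Computable.nat_mul (Computable.nat_pow (Computable.const 4)
        (Computable.nat_add Computable.id (Computable.const c)))
        (Computable.int_toNat.comp (hnum.comp h2))) (hden.comp h2)) (Computable.const 2)
  · rw [div_le_iff₀ (by positivity)]
    have h4 : (0 : ℝ) < 4 ^ (s + c) := by positivity
    rcases (hsub (s + c)).2 with h | h
    · rw [h]
      positivity
    · linarith
  · have h1 := (hsub (s + c)).1
    have h4 : (0 : ℝ) < 4 ^ (s + c) := by positivity
    have e : (4 : ℝ) ^ (s + c) * ((1 / 4) ^ c * (1 / 4) ^ s) = 1 := by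
      rw [← pow_add, add_comm c s, ← mul_pow]; norm_num
    have h2 : T - (b (s + c) - 2 : ℕ) / 4 ^ (s + c) ≤ 4 * ((1 / 4) ^ c * (1 / 4) ^ s) := by
      rw [← sub_nonneg]
      have : 4 * ((1 / 4 : ℝ) ^ c * (1 / 4) ^ s) - (T - (b (s + c) - 2 : ℕ) / 4 ^ (s + c)) =
          (4 - 4 ^ (s + c) * T + (b (s + c) - 2 : ℕ)) / 4 ^ (s + c) := by
        rw [eq_div_iff h4.ne', sub_mul, sub_mul, div_mul_cancel₀ _ h4.ne']
        linear_combination 4 * e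
      rw [this]
      exact div_nonneg (by linarith) h4.le
    have h3 : (1 / 4 : ℝ) ^ c * (1 / 4) ^ s ≤ T / 8 * (1 / 4) ^ s := by gcongr
    linarith

/-- `4 ^ s * 2 ^ (-k / t)`, rounded down, for the rational temperature `t = u / v`. It is computed by
counting the positive integers `m` with `m ^ u * 2 ^ (k * v) ≤ 2 ^ (2 * s * u)`. -/
def truncatedWeight (u v s k : ℕ) : ℕ :=
  ∑ m ∈ Finset.range (4 ^ s),
    bif decide ((m + 1) ^ u * 2 ^ (k * v) ≤ 2 ^ (2 * s * u)) then 1 else 0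

theorem truncatedWeight_eq_floor {u v : ℕ} (hu : 0 < u) (s k : ℕ) :
    truncatedWeight u v s k = ⌊(4 : ℝ) ^ s * 2 ^ (-(k : ℝ) / (u / v))⌋₊ := by
  have huR : (u : ℝ) ≠ 0 := by positivity
  set x : ℝ := (4 : ℝ) ^ s * 2 ^ (-(k : ℝ) / (u / v)) with hx
  have hx0 : 0 ≤ x := by positivity
  have hxu : x ^ u * 2 ^ (k * v) = 2 ^ (2 * s * u) := by
    rw [hx, mul_pow, ← Real.rpow_natCast (2 ^ (-(k : ℝ) / (u / v))), ← Real.rpow_mul two_pos.le]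
    have e : -(k : ℝ) / (u / v) * (u : ℕ) = -((k * v : ℕ) : ℝ) := by
      push_cast
      rw [neg_div, neg_mul, div_div_eq_mul_div, div_mul_cancel₀ _ huR]
    rw [e, Real.rpow_neg two_pos.le, Real.rpow_natCast, mul_assoc,
      inv_mul_cancel₀ (by positivity), mul_one, ← pow_mul, show (4 : ℝ) = 2 ^ 2 by norm_num,
      ← pow_mul, mul_assoc]
  have hx4 : x ≤ ((4 ^ s : ℕ) : ℝ) := by
    push_cast
    refine mul_le_of_le_one_right (by positivity) (Real.rpow_le_one_of_one_le_of_nonpos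
      one_le_two ?_)
    rw [neg_div]
    exact neg_nonpos.2 (by positivity)
  have hiff : ∀ m : ℕ, (m + 1) ^ u * 2 ^ (k * v) ≤ 2 ^ (2 * s * u) ↔ m < ⌊x⌋₊ := by
    intro m
    have h1 : (m + 1) ^ u * 2 ^ (k * v) ≤ 2 ^ (2 * s * u) ↔
        ((m + 1 : ℕ) : ℝ) ^ u * 2 ^ (k * v) ≤ 2 ^ (2 * s * u) := by exact_mod_cast Iff.rfl
    rw [h1, ← hxu, mul_le_mul_iff_left₀ (by positivity),
      pow_le_pow_iff_left₀ (by positivity) hx0 hu.ne', ← Nat.succ_le_iff, Nat.le_floor_iff hx0]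
  have hfl : ⌊x⌋₊ ≤ 4 ^ s := Nat.floor_le_of_le hx4
  unfold truncatedWeight
  have : ∀ m, (bif decide ((m + 1) ^ u * 2 ^ (k * v) ≤ 2 ^ (2 * s * u)) then 1 else 0) =
      if m < ⌊x⌋₊ then 1 else 0 := by
    intro m
    simp only [hiff]
    by_cases h : m < ⌊x⌋₊ <;> simp [h]
  simp only [this]
  rw [← Finset.sum_filter, Finset.sum_const, smul_eq_mul, mul_one]
  have : (Finset.range (4 ^ s)).filter (fun m => m < ⌊x⌋₊) = Finset.range ⌊x⌋₊ := by
    ext m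
    simp only [Finset.mem_filter, Finset.mem_range]
    omega
  rw [this, Finset.card_range]

theorem computable_truncatedWeight {α : Type*} [Primcodable α] {u v s k : α → ℕ}
    (hu : Computable u) (hv : Computable v) (hs : Computable s) (hk : Computable k) :
    Computable fun a => truncatedWeight (u a) (v a) (s a) (k a) := by
  open Computable in
  exact nat_sum_range (nat_pow (const 4) hs) (Computable.cond (decide_nat_le
    (nat_mul (nat_pow (nat_add snd (const 1)) (hu.comp fst))
      (nat_pow (const 2) (nat_mul (hk.comp fst) (hv.comp fst))))
    (nat_pow (const 2) (nat_mul (nat_mul (const 2) (hs.comp fst)) (hu.comp fst))))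
    (const 1) (const 0)).to₂

/-- The weights depend on the temperature in a Lipschitz way, uniformly in the length. -/
theorem rpow_neg_div_sub_le {T t : ℝ} (hT0 : 0 < T) (hT1 : T < 1) (ht : T / 2 ≤ t) (htT : t ≤ T)
    (k : ℕ) : (2 : ℝ) ^ (-(k : ℝ) / T) - 2 ^ (-(k : ℝ) / t) ≤ 2 / T ^ 2 * (T - t) := by
  have ht0 : 0 < t := by linarith
  set x : ℝ := k / t - k / T with hx
  have hk0 : (0 : ℝ) ≤ k := Nat.cast_nonneg k
  have hx0 : 0 ≤ x := sub_nonneg.2 (div_le_div_of_nonneg_left hk0 ht0 htT)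
  have hxle : x ≤ k * (2 / T ^ 2 * (T - t)) := by
    have e : x = k * ((T - t) / (t * T)) := by rw [hx]; field_simp
    rw [e]
    refine mul_le_mul_of_nonneg_left ?_ hk0
    rw [div_mul_eq_mul_div, div_le_div_iff₀ (by positivity) (by positivity)]
    nlinarith [mul_nonneg (sub_nonneg.2 htT) (mul_nonneg (by linarith : (0 : ℝ) ≤ 2 * t - T) hT0.le)]
  have e1 : (2 : ℝ) ^ (-(k : ℝ) / t) = 2 ^ (-(k : ℝ) / T) * 2 ^ (-x) := by
    rw [← Real.rpow_add two_pos]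
    congr 1
    rw [hx]
    ring
  have h1 : 1 - x ≤ (2 : ℝ) ^ (-x) := by
    rw [Real.rpow_def_of_pos two_pos]
    have h2 := Real.add_one_le_exp (Real.log 2 * -x)
    have h3 : Real.log 2 ≤ 1 := by linarith [Real.log_two_lt_d9]
    nlinarith
  have h2 : (2 : ℝ) ^ (-(k : ℝ) / T) * k ≤ 1 := by
    have h3 : (2 : ℝ) ^ (-(k : ℝ) / T) ≤ 2 ^ (-(k : ℝ)) := by
      refine Real.rpow_le_rpow_of_exponent_le one_le_two ?_
      rw [neg_div]
      exact neg_le_neg ((le_div_iff₀ hT0).2 (mul_le_of_le_one_right hk0 hT1.le))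
    have h4 : (2 : ℝ) ^ (-(k : ℝ)) * k ≤ 1 := by
      rw [Real.rpow_neg two_pos.le, Real.rpow_natCast, inv_mul_le_iff₀ (by positivity), mul_one]
      exact_mod_cast Nat.lt_two_pow_self.le
    exact (mul_le_mul_of_nonneg_right h3 hk0).trans h4
  have hw : (0 : ℝ) < 2 ^ (-(k : ℝ) / T) := by positivity
  have hd : 0 ≤ 2 / T ^ 2 * (T - t) := mul_nonneg (by positivity) (by linarith)
  rw [e1]
  have h5 := mul_le_mul_of_nonneg_left h1 hw.le
  have h6 := mul_le_mul_of_nonneg_left hxle hw.le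
  have h7 := mul_le_mul_of_nonneg_right h2 hd
  linarith

/-! ### Approximating the partition function -/

theorem Real.sum_rpow_le_sum_rpow {ι : Type*} (F : Finset ι) {w : ι → ℝ} (hw : ∀ i, 0 ≤ w i)
    {T : ℝ} (hT0 : 0 < T) (hT1 : T ≤ 1) : (∑ i ∈ F, w i) ^ T ≤ ∑ i ∈ F, w i ^ T := by
  classical
  induction F using Finset.induction_on with
  | empty => simp [Real.zero_rpow hT0.ne']
  | insert i F hi ih =>
    rw [Finset.sum_insert hi, Finset.sum_insert hi]
    exact (Real.rpow_add_le_add_rpow (hw i) (Finset.sum_nonneg fun j _ => hw j) hT0.le hT1).trans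
      (by gcongr)

/-- The weight `2 ^ (-|p| / T)` of a string at temperature `T`. -/
noncomputable def stringWeight (T : ℝ) (p : List Bool) : ℝ := (2 : ℝ) ^ (-(p.length : ℝ) / T)

theorem stringWeight_pos (T : ℝ) (p : List Bool) : 0 < stringWeight T p := by
  unfold stringWeight
  positivity

theorem stringWeight_rpow {T : ℝ} (hT0 : 0 < T) (p : List Bool) :
    stringWeight T p ^ T = (1 / 2 : ℝ) ^ p.length := by
  rw [stringWeight, ← Real.rpow_mul two_pos.le, div_mul_cancel₀ _ hT0.ne', Real.rpow_neg two_pos.le,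
    Real.rpow_natCast, one_div_pow, one_div]

theorem stringWeight_le {T : ℝ} (hT0 : 0 < T) (hT1 : T < 1) (p : List Bool) :
    stringWeight T p ≤ (1 / 2 : ℝ) ^ p.length := by
  rw [← stringWeight_rpow hT0]
  have h1 : stringWeight T p ≤ 1 := by
    refine Real.rpow_le_one_of_one_le_of_nonpos one_le_two ?_
    rw [neg_div]
    exact neg_nonpos.2 (by positivity)
  simpa using Real.rpow_le_rpow_of_exponent_ge (stringWeight_pos T p) h1 hT1.le

theorem PrefixFree.summable_indicator_stringWeight {S : Set (List Bool)} (hS : PrefixFree S)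
    {T : ℝ} (hT0 : 0 < T) (hT1 : T < 1) : Summable (S.indicator (stringWeight T)) := by
  classical
  refine summable_of_sum_le (c := 1)
    (fun p => Set.indicator_nonneg (fun p _ => (stringWeight_pos T p).le) p) fun F => ?_
  rw [← Finset.sum_filter_of_ne (p := (· ∈ S)) fun p _ h => Set.mem_of_indicator_ne_zero h]
  refine le_trans (Finset.sum_le_sum fun p hp => ?_)
    (hS.sum_le_one fun p hp => (Finset.mem_filter.1 hp).2)
  rw [Set.indicator_of_mem (Finset.mem_filter.1 hp).2]
  exact stringWeight_le hT0 hT1 p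

section Stages

/-- The natural number `A` such that `A / 4 ^ s` is the sum of the weights of the strings in `H s`,
computed with precision `4 ^ (-s)` at the temperature `u s / 4 ^ (s + c)`. -/
def stageNumerator (H : ℕ → Finset (List Bool)) (u : ℕ → ℕ) (c s : ℕ) : ℕ :=
  ∑ p ∈ H s, truncatedWeight (u s) (4 ^ (s + c)) s p.length

variable {H : ℕ → Finset (List Bool)} {u : ℕ → ℕ} {c : ℕ} {T : ℝ}

theorem truncatedWeight_bounds (hT0 : 0 < T) (hT1 : T < 1)
    (hu : ∀ s, (u s : ℝ) / 4 ^ (s + c) ≤ T ∧ T - u s / 4 ^ (s + c) ≤ T / 2 * (1 / 4) ^ s)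
    (s : ℕ) (p : List Bool) :
    truncatedWeight (u s) (4 ^ (s + c)) s p.length / 4 ^ s ≤ stringWeight T p ∧
      stringWeight T p - (1 / T + 1) * (1 / 4) ^ s ≤
        truncatedWeight (u s) (4 ^ (s + c)) s p.length / 4 ^ s := by
  obtain ⟨h1, h2⟩ := hu s
  have h4 : (0 : ℝ) < 4 ^ s := by positivity
  have hq1 : (1 / 4 : ℝ) ^ s ≤ 1 := pow_le_one₀ (by norm_num) (by norm_num)
  have hhalf : T / 2 ≤ u s / 4 ^ (s + c) := by nlinarith
  have ht0 : (0 : ℝ) < u s / 4 ^ (s + c) := by linarith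
  have hupos : 0 < u s := by
    rcases Nat.eq_zero_or_pos (u s) with h | h
    · rw [h] at ht0
      simp at ht0
    · exact h
  rw [truncatedWeight_eq_floor hupos]
  push_cast
  have hk0 : (0 : ℝ) ≤ p.length := Nat.cast_nonneg _
  set t : ℝ := u s / 4 ^ (s + c)
  have hx0 : (0 : ℝ) ≤ 4 ^ s * 2 ^ (-(p.length : ℝ) / t) := by positivity
  have hf1 := Nat.floor_le hx0
  have hf2 := Nat.lt_floor_add_one ((4 : ℝ) ^ s * 2 ^ (-(p.length : ℝ) / t))
  have hle : (2 : ℝ) ^ (-(p.length : ℝ) / t) ≤ stringWeight T p := by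
    refine Real.rpow_le_rpow_of_exponent_le one_le_two ?_
    rw [neg_div, neg_div]
    exact neg_le_neg (div_le_div_of_nonneg_left hk0 ht0 h1)
  have hlip := rpow_neg_div_sub_le hT0 hT1 hhalf h1 p.length
  have e4 : (1 / 4 : ℝ) ^ s * 4 ^ s = 1 := by rw [← mul_pow]; norm_num
  constructor
  · rw [div_le_iff₀ h4]
    have := mul_le_mul_of_nonneg_right hle h4.le
    linarith
  · rw [le_div_iff₀ h4]
    have h5 : 2 / T ^ 2 * (T - t) ≤ 1 / T * (1 / 4) ^ s := by
      have := mul_le_mul_of_nonneg_left h2 (show 0 ≤ 2 / T ^ 2 by positivity)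
      have e : 2 / T ^ 2 * (T / 2 * (1 / 4) ^ s) = 1 / T * (1 / 4) ^ s := by field_simp
      linarith
    have h6 : stringWeight T p - 1 / T * (1 / 4) ^ s ≤ 2 ^ (-(p.length : ℝ) / t) := by
      unfold stringWeight
      linarith
    have := mul_le_mul_of_nonneg_right h6 h4.le
    have e7 : (stringWeight T p - (1 / T + 1) * (1 / 4) ^ s) * 4 ^ s =
        (stringWeight T p - 1 / T * (1 / 4) ^ s) * 4 ^ s - 1 := by
      linear_combination -e4
    rw [e7]
    linarith

theorem stageNumerator_bounds (hH : ∀ s, (H s).card ≤ s) (hT0 : 0 < T) (hT1 : T < 1)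
    (hu : ∀ s, (u s : ℝ) / 4 ^ (s + c) ≤ T ∧ T - u s / 4 ^ (s + c) ≤ T / 2 * (1 / 4) ^ s)
    (s : ℕ) :
    stageNumerator H u c s / 4 ^ s ≤ ∑ p ∈ H s, stringWeight T p ∧
      ∑ p ∈ H s, stringWeight T p - (1 / T + 1) * (1 / 2) ^ s ≤ stageNumerator H u c s / 4 ^ s := by
  unfold stageNumerator
  push_cast
  rw [Finset.sum_div]
  refine ⟨Finset.sum_le_sum fun p _ => (truncatedWeight_bounds hT0 hT1 hu s p).1, ?_⟩
  have h1 : ∑ p ∈ H s, (stringWeight T p - (1 / T + 1) * (1 / 4) ^ s) ≤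
      ∑ p ∈ H s, (truncatedWeight (u s) (4 ^ (s + c)) s p.length : ℝ) / 4 ^ s :=
    Finset.sum_le_sum fun p _ => (truncatedWeight_bounds hT0 hT1 hu s p).2
  rw [Finset.sum_sub_distrib, Finset.sum_const, nsmul_eq_mul] at h1
  have h2 : ((H s).card : ℝ) ≤ 2 ^ s := by
    exact_mod_cast (hH s).trans Nat.lt_two_pow_self.le
  have h3 : ((H s).card : ℝ) * ((1 / T + 1) * (1 / 4) ^ s) ≤ (1 / T + 1) * (1 / 2) ^ s := by
    calc ((H s).card : ℝ) * ((1 / T + 1) * (1 / 4) ^ s)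
        ≤ 2 ^ s * ((1 / T + 1) * (1 / 4) ^ s) := by gcongr
      _ = (1 / T + 1) * (2 * (1 / 4)) ^ s := by rw [mul_pow]; ring
      _ = (1 / T + 1) * (1 / 2) ^ s := by norm_num
  linarith

theorem monotone_stageNumerator_div (hH : Monotone H) (hT0 : 0 < T)
    (humono : Monotone (fun s => (u s : ℝ) / 4 ^ (s + c)))
    (hu : ∀ s, (u s : ℝ) / 4 ^ (s + c) ≤ T ∧ T - u s / 4 ^ (s + c) ≤ T / 2 * (1 / 4) ^ s) :
    Monotone fun s => (stageNumerator H u c s : ℝ) / 4 ^ s := by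
  have ht0 : ∀ s, (0 : ℝ) < u s / 4 ^ (s + c) := by
    intro s
    have hq1 : (1 / 4 : ℝ) ^ s ≤ 1 := pow_le_one₀ (by norm_num) (by norm_num)
    nlinarith [(hu s).2]
  have hupos : ∀ s, 0 < u s := by
    intro s
    rcases Nat.eq_zero_or_pos (u s) with h | h
    · have := ht0 s
      rw [h] at this
      simp at this
    · exact h
  refine monotone_nat_of_le_succ fun s => ?_
  have hterm : ∀ k, truncatedWeight (u s) (4 ^ (s + c)) s k * 4 ≤
      truncatedWeight (u (s + 1)) (4 ^ (s + 1 + c)) (s + 1) k := by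
    intro k
    rw [truncatedWeight_eq_floor (hupos s), truncatedWeight_eq_floor (hupos (s + 1)),
      Nat.le_floor_iff (by positivity)]
    push_cast
    have h1 := Nat.floor_le
      (show (0 : ℝ) ≤ 4 ^ s * 2 ^ (-(k : ℝ) / (u s / 4 ^ (s + c))) by positivity)
    have h2 : (2 : ℝ) ^ (-(k : ℝ) / (u s / 4 ^ (s + c))) ≤
        2 ^ (-(k : ℝ) / (u (s + 1) / 4 ^ (s + 1 + c))) := by
      refine Real.rpow_le_rpow_of_exponent_le one_le_two ?_
      rw [neg_div, neg_div]
      exact neg_le_neg (div_le_div_of_nonneg_left (Nat.cast_nonneg k) (ht0 s)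
        (humono (Nat.le_succ s)))
    have h3 := mul_le_mul_of_nonneg_left h2 (show (0 : ℝ) ≤ 4 ^ (s + 1) by positivity)
    rw [pow_succ] at h3 ⊢
    linarith
  have hsum : stageNumerator H u c s * 4 ≤ stageNumerator H u c (s + 1) := by
    unfold stageNumerator
    rw [Finset.sum_mul]
    exact (Finset.sum_le_sum fun p _ => hterm p.length).trans
      (Finset.sum_le_sum_of_subset (hH (Nat.le_succ s)))
  have hsum' : (stageNumerator H u c s : ℝ) * 4 ≤ stageNumerator H u c (s + 1) := by
    exact_mod_cast hsum
  rw [div_le_div_iff₀ (by positivity) (by positivity), pow_succ]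
  have := mul_le_mul_of_nonneg_right hsum' (show (0 : ℝ) ≤ 4 ^ s by positivity)
  linarith

/-- The `T`-th power turns the weights at temperature `T` into the weights `2 ^ (-|p|)` of Kraft's
inequality, so the increments of the approximations have a bounded sum of `T`-th powers. -/
theorem exists_sum_increment_rpow_le {S : Set (List Bool)} (hS : PrefixFree S)
    (hHS : ∀ s, ∀ p ∈ H s, p ∈ S) (hH : Monotone H) (hT0 : 0 < T) (hT1 : T < 1) {a : ℕ → ℝ}
    (ha : Monotone a) {K : ℝ} (hK0 : 0 ≤ K)
    (hK : ∀ s, a s ≤ ∑ p ∈ H s, stringWeight T p ∧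
      ∑ p ∈ H s, stringWeight T p - K * (1 / 2) ^ s ≤ a s) :
    ∃ B : ℝ, ∀ N, ∑ s ∈ Finset.range N, (a (s + 1) - a s) ^ T ≤ B := by
  classical
  have hhalf : (0 : ℝ) < 1 / 2 := by norm_num
  set q : ℝ := (1 / 2 : ℝ) ^ T with hq
  have hq0 : 0 ≤ q := by positivity
  have hq1 : q < 1 := Real.rpow_lt_one (by norm_num) (by norm_num) hT0
  have hstep : ∀ s, (a (s + 1) - a s) ^ T ≤
      (∑ p ∈ H (s + 1), (1 / 2 : ℝ) ^ p.length - ∑ p ∈ H s, (1 / 2 : ℝ) ^ p.length) +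
        K ^ T * q ^ s := by
    intro s
    have hsub := hH (Nat.le_succ s)
    have h1 : a (s + 1) - a s ≤
        ∑ p ∈ H (s + 1) \ H s, stringWeight T p + K * (1 / 2) ^ s := by
      have := Finset.sum_sdiff (f := stringWeight T) hsub
      linarith [(hK (s + 1)).1, (hK s).2]
    have hn : 0 ≤ ∑ p ∈ H (s + 1) \ H s, stringWeight T p :=
      Finset.sum_nonneg fun p _ => (stringWeight_pos T p).le
    have hn2 : 0 ≤ K * (1 / 2) ^ s := by positivity
    calc (a (s + 1) - a s) ^ T
        ≤ (∑ p ∈ H (s + 1) \ H s, stringWeight T p + K * (1 / 2) ^ s) ^ T :=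
          Real.rpow_le_rpow (sub_nonneg.2 (ha (Nat.le_succ s))) h1 hT0.le
      _ ≤ (∑ p ∈ H (s + 1) \ H s, stringWeight T p) ^ T + (K * (1 / 2) ^ s) ^ T :=
          Real.rpow_add_le_add_rpow hn hn2 hT0.le hT1.le
      _ ≤ ∑ p ∈ H (s + 1) \ H s, stringWeight T p ^ T + (K * (1 / 2) ^ s) ^ T := by
          gcongr
          exact Real.sum_rpow_le_sum_rpow _ (fun p => (stringWeight_pos T p).le) hT0 hT1.le
      _ = _ := by
          simp only [stringWeight_rpow hT0]
          rw [← Finset.sum_sdiff hsub, add_sub_cancel_right, Real.mul_rpow hK0 (by positivity), hq,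
            ← Real.rpow_natCast, ← Real.rpow_natCast, ← Real.rpow_mul hhalf.le,
            ← Real.rpow_mul hhalf.le, mul_comm (s : ℝ) T]
  refine ⟨1 + K ^ T * (1 - q)⁻¹, fun N => (Finset.sum_le_sum fun s _ => hstep s).trans ?_⟩
  rw [Finset.sum_add_distrib, Finset.sum_range_sub (fun s => ∑ p ∈ H s, (1 / 2 : ℝ) ^ p.length),
    ← Finset.mul_sum]
  have h1 := hS.sum_le_one (hHS N)
  have h2 : 0 ≤ ∑ p ∈ H 0, (1 / 2 : ℝ) ^ p.length := Finset.sum_nonneg fun p _ => by positivity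
  have h3 : ∑ s ∈ Finset.range N, q ^ s ≤ (1 - q)⁻¹ := by
    rw [← tsum_geometric_of_lt_one hq0 hq1]
    exact (summable_geometric_of_lt_one hq0 hq1).sum_le_tsum _ fun s _ => by positivity
  have h4 := mul_le_mul_of_nonneg_left h3 (show 0 ≤ K ^ T by positivity)
  linarith

/-- Every real below the sum of the weights on an increasing union is below a finite stage. -/
theorem eventually_lt_sum_stringWeight {S : Set (List Bool)} (hS : PrefixFree S)
    (hHS : ∀ p, p ∈ S ↔ ∃ s, p ∈ H s) (hH : Monotone H) (hT0 : 0 < T) (hT1 : T < 1) {r : ℝ}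
    (hr : r < ∑' p, S.indicator (stringWeight T) p) :
    ∀ᶠ s in Filter.atTop, r < ∑ p ∈ H s, stringWeight T p := by
  classical
  have hsum := (hS.summable_indicator_stringWeight hT0 hT1).hasSum
  obtain ⟨F, hF⟩ := (hsum.eventually (lt_mem_nhds hr)).exists
  have hsub : ∀ G : Finset (List Bool), (∀ p ∈ G, p ∈ S) → ∃ s, G ⊆ H s := by
    intro G
    induction G using Finset.induction_on with
    | empty => exact fun _ => ⟨0, Finset.empty_subset _⟩
    | insert p G _ ih =>
      intro h
      obtain ⟨s, hs⟩ := ih fun q hq => h q (Finset.mem_insert_of_mem hq)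
      obtain ⟨t, ht⟩ := (hHS p).1 (h p (Finset.mem_insert_self _ _))
      exact ⟨max s t, Finset.insert_subset (hH (le_max_right s t) ht)
        (hs.trans (hH (le_max_left s t)))⟩
  obtain ⟨s, hs⟩ := hsub (F.filter (· ∈ S)) fun p hp => (Finset.mem_filter.1 hp).2
  filter_upwards [Filter.eventually_ge_atTop s] with t ht
  refine hF.trans_le ?_
  rw [← Finset.sum_filter_of_ne (p := (· ∈ S)) fun p _ h => Set.mem_of_indicator_ne_zero h]
  calc ∑ p ∈ F.filter (· ∈ S), S.indicator (stringWeight T) p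
      = ∑ p ∈ F.filter (· ∈ S), stringWeight T p := Finset.sum_congr rfl fun p hp =>
        Set.indicator_of_mem (Finset.mem_filter.1 hp).2 _
    _ ≤ ∑ p ∈ H t, stringWeight T p := Finset.sum_le_sum_of_subset_of_nonneg (hs.trans (hH ht))
        fun p _ _ => (stringWeight_pos T p).le

end Stages

/-! ### The requests and the proof of predictability -/

/-- The integer part of `T * n`, up to an error of at most `2`, computed from the approximations of
`T`. -/
def levelLength (u : ℕ → ℕ) (c n : ℕ) : ℕ := n * u n / 4 ^ (n + c)

section LevelLength

variable {u : ℕ → ℕ} {c : ℕ} {T : ℝ}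

theorem levelLength_le (hu : ∀ s, (u s : ℝ) / 4 ^ (s + c) ≤ T) (n : ℕ) :
    (levelLength u c n : ℝ) ≤ T * n := by
  have h : (levelLength u c n : ℝ) ≤ ((n * u n : ℕ) : ℝ) / ((4 ^ (n + c) : ℕ) : ℝ) := Nat.cast_div_le
  push_cast at h
  rw [mul_div_assoc] at h
  have := mul_le_mul_of_nonneg_left (hu n) (Nat.cast_nonneg (α := ℝ) n)
  linarith

theorem pow_levelLength_le (hT0 : 0 < T) (hT1 : T < 1)
    (hu : ∀ s, T - u s / 4 ^ (s + c) ≤ T / 2 * (1 / 4) ^ s) (n : ℕ) :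
    (1 / 2 : ℝ) ^ levelLength u c n ≤ 4 * ((2 : ℝ) ^ (-T)) ^ n := by
  have h1 : T * n - 2 ≤ levelLength u c n := by
    have e := Nat.floor_div_eq_div (K := ℝ) (n * u n) (4 ^ (n + c))
    have h2 := Nat.lt_floor_add_one (((n * u n : ℕ) : ℝ) / ((4 ^ (n + c) : ℕ) : ℝ))
    rw [e] at h2
    change _ < (levelLength u c n : ℝ) + 1 at h2
    push_cast at h2
    rw [mul_div_assoc] at h2
    have hn : (n : ℝ) * (1 / 4) ^ n ≤ 1 := by
      rw [one_div_pow, mul_one_div, div_le_one (by positivity)]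
      exact_mod_cast (Nat.lt_pow_self (by norm_num : 1 < 4)).le
    have h3 := mul_le_mul_of_nonneg_left (hu n) (Nat.cast_nonneg (α := ℝ) n)
    have h4 : (n : ℝ) * (T / 2 * (1 / 4) ^ n) ≤ 1 := by
      have : (n : ℝ) * (T / 2 * (1 / 4) ^ n) = T / 2 * (n * (1 / 4) ^ n) := by ring
      rw [this]
      nlinarith
    linarith
  have e1 : (1 / 2 : ℝ) ^ levelLength u c n = 2 ^ (-(levelLength u c n : ℝ)) := by
    rw [Real.rpow_neg two_pos.le, Real.rpow_natCast, one_div_pow, one_div]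
  have e2 : 4 * ((2 : ℝ) ^ (-T)) ^ n = 2 ^ (2 - T * n) := by
    rw [← Real.rpow_natCast, ← Real.rpow_mul two_pos.le, sub_eq_add_neg, Real.rpow_add two_pos,
      neg_mul]
    norm_num
  rw [e1, e2]
  exact Real.rpow_le_rpow_of_exponent_le one_le_two (by linarith)

end LevelLength

theorem sum_range_unpair_le {F : ℕ → ℕ → ℝ} (hF : ∀ s n, 0 ≤ F s n) (N : ℕ) :
    ∑ i ∈ Finset.range N, F i.unpair.1 i.unpair.2 ≤
      ∑ s ∈ Finset.range N, ∑ n ∈ Finset.range N, F s n := by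
  rw [← Finset.sum_product', ← Finset.sum_image (f := fun x : ℕ × ℕ => F x.1 x.2)
    (g := Nat.unpair) (Nat.pairEquiv.symm.injective.injOn)]
  refine Finset.sum_le_sum_of_subset_of_nonneg (fun x hx => ?_) fun x _ _ => hF _ _
  obtain ⟨i, hi, rfl⟩ := Finset.mem_image.1 hx
  rw [Finset.mem_range] at hi
  exact Finset.mem_product.2 ⟨Finset.mem_range.2 ((Nat.unpair_left_le i).trans_lt hi),
    Finset.mem_range.2 ((Nat.unpair_right_le i).trans_lt hi)⟩

theorem floor_pow_mul_natCast_div (A n s : ℕ) :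
    ⌊(2 : ℝ) ^ n * (A / 4 ^ s)⌋ = ((2 ^ n * A / 4 ^ s : ℕ) : ℤ) := by
  have e : (2 : ℝ) ^ n * (A / 4 ^ s) = ((2 ^ n * A : ℕ) : ℝ) / ((4 ^ s : ℕ) : ℝ) := by
    push_cast
    ring
  rw [e, ← Nat.floor_div_eq_div (K := ℝ), Int.natCast_floor_eq_floor (by positivity)]

/-- For an optimal machine and large `m` the binary expansion of the partition function has no block
of `m` zeros, except at the beginning or within an all-zero tail. When the approximations to the
partition function reach its first `n` bits, a string that is not yet a value of the machine gets a
program of length `T n + O(1)`. So the machine has a program of this length that halts later, and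
its weight keeps the partition function away from the number given by the first `n` bits. -/
theorem exists_le_fract_partitionSum {U : List Bool →. List Bool}
    (hU : IsOptimalPrefixFreeMachine U) {T : ℝ} (hT : IsComputableReal T) (hT0 : 0 < T)
    (hT1 : T < 1) :
    letI α := ∑' p, U.Dom.indicator (stringWeight T) p
    ∃ m N : ℕ, ∀ n ≥ N, 0 < Int.fract (2 ^ n * α) → 1 ≤ 2 ^ m * Int.fract (2 ^ n * α) := by
  classical
  obtain ⟨⟨hpart, hpf⟩, hopt⟩ := hU
  obtain ⟨H, out, hH0, hHmono, hHcard, hHdom, hHsum, hout, hfresh⟩ := exists_stages hpart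
  obtain ⟨c, u, hucomp, humono, hu⟩ := hT.exists_lower_approx hT0
  have hsummable := hpf.summable_indicator_stringWeight hT0 hT1
  set α : ℝ := ∑' p, U.Dom.indicator (stringWeight T) p with hα
  have hα0 : 0 ≤ α := tsum_nonneg fun p =>
    Set.indicator_nonneg (fun p _ => (stringWeight_pos T p).le) p
  set A : ℕ → ℕ := stageNumerator H u c with hA
  set a : ℕ → ℝ := fun s => (A s : ℝ) / 4 ^ s with ha
  have hamono : Monotone a := monotone_stageNumerator_div hHmono hT0 humono hu
  have ha0 : a 0 = 0 := by simp [ha, hA, stageNumerator, hH0]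
  have hab := stageNumerator_bounds (c := c) hHcard hT0 hT1 hu
  have hK0 : 0 ≤ 1 / T + 1 := by positivity
  obtain ⟨B, hB⟩ := exists_sum_increment_rpow_le hpf (fun s p hp => (hHdom p).2 ⟨s, hp⟩) hHmono
    hT0 hT1 hamono hK0 hab
  obtain ⟨C, hC⟩ := exists_sum_floor_change_le hT0 hT1 hamono ha0 hB
  -- Shifting all lengths by `c₀` makes the total weight of the requests at most `1`.
  obtain ⟨c₀, hc₀⟩ : ∃ c₀ : ℕ, 4 * C * (1 / 2 : ℝ) ^ c₀ ≤ 1 := by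
    obtain ⟨k, hk⟩ := pow_unbounded_of_one_lt (4 * C) one_lt_two
    refine ⟨k, ?_⟩
    rw [one_div_pow, mul_one_div, div_le_one (by positivity)]
    exact hk.le
  let change : ℕ → ℕ → Bool := fun s n =>
    !decide (2 ^ n * A s / 4 ^ s = 2 ^ n * A (s + 1) / 4 ^ (s + 1))
  let act : ℕ → Bool := fun i => change i.unpair.1 i.unpair.2
  let len : ℕ → ℕ := fun i => levelLength u c i.unpair.2 + c₀
  have hchange : ∀ s n, change s n = true ↔ ⌊2 ^ n * a s⌋ ≠ ⌊2 ^ n * a (s + 1)⌋ := by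
    intro s n
    simp only [ha, floor_pow_mul_natCast_div, change, Bool.not_eq_true', decide_eq_false_iff_not,
      ne_eq, Nat.cast_inj]
  have hAcomp : Computable A := by
    open Computable in
    exact hHsum _ (computable_truncatedWeight (hucomp.comp fst)
      (nat_pow (const 4) (nat_add fst (const c))) fst (list_length.comp snd))
  have hsnd : Computable fun i : ℕ => i.unpair.2 := Computable.snd.comp Computable.unpair
  have hfst : Computable fun i : ℕ => i.unpair.1 := Computable.fst.comp Computable.unpair
  have hfst1 : Computable fun i : ℕ => i.unpair.1 + 1 :=
    Computable.nat_add hfst (Computable.const 1)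
  have hactcomp : Computable act := by
    open Computable in
    have hp : Computable fun i : ℕ => 2 ^ i.unpair.2 := nat_pow (const 2) hsnd
    exact bnot (decide_nat_eq
      (nat_div (nat_mul hp (hAcomp.comp hfst)) (nat_pow (const 4) hfst))
      (nat_div (nat_mul hp (hAcomp.comp hfst1)) (nat_pow (const 4) hfst1)))
  have hlencomp : Computable len := by
    open Computable in
    exact nat_add (nat_div (nat_mul hsnd (hucomp.comp hsnd))
      (nat_pow (const 4) (nat_add hsnd (const c)))) (const c₀)
  have hweight : ∀ N, requestSum act len N ≤ 1 := by
    intro N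
    have h1 : ∀ s n, (if change s n then (1 / 2 : ℝ) ^ (levelLength u c n + c₀) else 0) ≤
        4 * (1 / 2) ^ c₀ *
          (if ⌊2 ^ n * a s⌋ = ⌊2 ^ n * a (s + 1)⌋ then 0 else ((2 : ℝ) ^ (-T)) ^ n) := by
      intro s n
      by_cases h : change s n = true
      · rw [if_pos h, if_neg ((hchange s n).1 h), pow_add]
        have := mul_le_mul_of_nonneg_right
          (pow_levelLength_le hT0 hT1 (fun s => (hu s).2) n)
          (show (0 : ℝ) ≤ (1 / 2) ^ c₀ by positivity)
        linarith
      · rw [if_neg h]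
        positivity
    calc requestSum act len N
        ≤ ∑ s ∈ Finset.range N, ∑ n ∈ Finset.range N,
            (if change s n then (1 / 2 : ℝ) ^ (levelLength u c n + c₀) else 0) :=
          sum_range_unpair_le (F := fun s n =>
            if change s n then (1 / 2 : ℝ) ^ (levelLength u c n + c₀) else 0)
            (fun s n => by split_ifs <;> positivity) N
      _ ≤ ∑ s ∈ Finset.range N, ∑ n ∈ Finset.range N, 4 * (1 / 2) ^ c₀ *
            (if ⌊2 ^ n * a s⌋ = ⌊2 ^ n * a (s + 1)⌋ then 0 else ((2 : ℝ) ^ (-T)) ^ n) :=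
          Finset.sum_le_sum fun s _ => Finset.sum_le_sum fun n _ => h1 s n
      _ ≤ 4 * (1 / 2) ^ c₀ * C := by
          simp only [← Finset.mul_sum]
          exact mul_le_mul_of_nonneg_left (hC N N) (by positivity)
      _ ≤ 1 := by linarith
  obtain ⟨M, hM, hMprog⟩ := exists_prefixFreeMachine_of_requests hactcomp hlencomp
    (hout.comp hfst1) hweight
  obtain ⟨d, hd⟩ := hopt M hM
  obtain ⟨m, hm⟩ := exists_nat_gt (((c₀ + 1 + d : ℕ) : ℝ) / T)
  rw [div_lt_iff₀ hT0] at hm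
  push_cast at hm
  rcases hα0.eq_or_lt with hzero | hpos
  · exact ⟨0, 0, fun n _ h => absurd h (by simp [← hzero])⟩
  obtain ⟨N, hN⟩ := pow_unbounded_of_one_lt (1 / α) (one_lt_two (α := ℝ))
  rw [div_lt_iff₀ hpos] at hN
  refine ⟨m, N, fun n hn hfr => ?_⟩
  by_contra hlt
  rw [not_le] at hlt
  have h2n : (0 : ℝ) < 2 ^ n := by positivity
  -- The number `r` given by the first `n` bits of `α`.
  set r : ℝ := ⌊2 ^ n * α⌋ / 2 ^ n with hr
  have hrα : r + Int.fract (2 ^ n * α) / 2 ^ n = α := by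
    rw [hr, ← add_div, Int.floor_add_fract, mul_div_cancel_left₀ _ h2n.ne']
  have hfr' : 0 < Int.fract (2 ^ n * α) / 2 ^ n := div_pos hfr h2n
  have hr0 : 0 < r := by
    have h1 : (1 : ℝ) ≤ 2 ^ n * α := by
      have : (2 : ℝ) ^ N * α ≤ 2 ^ n * α :=
        mul_le_mul_of_nonneg_right (pow_le_pow_right₀ one_le_two hn) hα0
      linarith
    have h2 : 1 ≤ ⌊2 ^ n * α⌋ := Int.le_floor.2 (by simpa using h1)
    exact div_pos (by exact_mod_cast h2) h2n
  have hreach : ∃ s, r ≤ a s := by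
    have h1 := eventually_lt_sum_stringWeight hpf hHdom hHmono hT0 hT1
      (r := (r + α) / 2) (by rw [← hα]; linarith)
    have h2 : Filter.Tendsto (fun s : ℕ => (1 / T + 1) * (1 / 2 : ℝ) ^ s) Filter.atTop (nhds 0) := by
      simpa using (tendsto_pow_atTop_nhds_zero_of_lt_one (r := (1 / 2 : ℝ)) (by norm_num)
        (by norm_num)).const_mul (1 / T + 1)
    have h3 := h2.eventually (gt_mem_nhds (show 0 < (α - r) / 2 by linarith))
    obtain ⟨s, hs1, hs2⟩ := (h1.and h3).exists
    exact ⟨s, by have := (hab s).2; change r ≤ (A s : ℝ) / 4 ^ s; linarith⟩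
  obtain ⟨s, hs⟩ : ∃ s, Nat.find hreach = s + 1 := by
    refine Nat.exists_eq_succ_of_ne_zero fun h0 => ?_
    have := Nat.find_spec hreach
    rw [h0, ha0] at this
    linarith
  have hs1 : r ≤ a (s + 1) := hs ▸ Nat.find_spec hreach
  have hs0 : a s < r := not_le.1 (Nat.find_min hreach (by omega))
  have hcross : change s n = true := by
    rw [hchange]
    refine ne_of_lt (lt_of_lt_of_le (b := ⌊2 ^ n * α⌋) ?_ ?_)
    · rw [Int.floor_lt]
      rw [hr, lt_div_iff₀ h2n] at hs0
      linarith
    · rw [Int.le_floor]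
      rw [hr, div_le_iff₀ h2n] at hs1
      linarith
  obtain ⟨p, hp, hplen⟩ := hMprog (Nat.pair s n) (by simp [act, hcross])
  obtain ⟨q, hq, hqlen⟩ := hd p _ hp
  rw [hplen] at hqlen
  simp only [Nat.unpair_pair, len] at hq hqlen
  have hqH : q ∉ H (s + 1) := fun h => hfresh _ q h hq
  have hweight_q : stringWeight T q ≤ α - r := by
    have h1 := hsummable.sum_le_tsum (insert q (H (s + 1)))
      fun p _ => Set.indicator_nonneg (fun p _ => (stringWeight_pos T p).le) p
    have hqU : q ∈ U.Dom := Part.dom_iff_mem.2 ⟨_, hq⟩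
    rw [Finset.sum_insert hqH, Set.indicator_of_mem hqU,
      Finset.sum_congr rfl fun p hp => Set.indicator_of_mem ((hHdom p).2 ⟨s + 1, hp⟩) _] at h1
    linarith [(hab (s + 1)).1]
  have hsmall : α - r < 2 ^ (-((n : ℝ) + m)) := by
    have e : (2 : ℝ) ^ (-((n : ℝ) + m)) = 1 / 2 ^ m / 2 ^ n := by
      rw [Real.rpow_neg two_pos.le, Real.rpow_add two_pos, Real.rpow_natCast, Real.rpow_natCast]
      field_simp
    have h1 : Int.fract (2 ^ n * α) < 1 / 2 ^ m := by
      rw [lt_div_iff₀ (by positivity)]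
      linarith
    rw [e]
    have := div_lt_div_of_pos_right h1 h2n
    linarith
  have hexp := (Real.rpow_lt_rpow_left_iff one_lt_two).1 (hweight_q.trans_lt hsmall)
  rw [neg_div, neg_lt_neg_iff, lt_div_iff₀ hT0] at hexp
  have hqlen' : (q.length : ℝ) ≤ levelLength u c n + c₀ + 1 + d := by exact_mod_cast hqlen
  have := levelLength_le (fun s => (hu s).1) n
  linarith

theorem theorem5 (U : List Bool →. List Bool) (hU : IsOptimalPrefixFreeMachine U)
    (T : ℝ) (hT : IsComputableReal T) (hT0 : 0 < T) (hT1 : T < 1) :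
    Summable (partitionTerm U T) ∧
      FiniteStateStronglyPredictable (baseTwoExpansion (partitionFunction U T)) := by
  have hsum : Summable (partitionTerm U T) :=
    summable_subtype_iff_indicator.2 (hU.1.2.summable_indicator_stringWeight hT0 hT1)
  have hZ : partitionFunction U T = ∑' p, U.Dom.indicator (stringWeight T) p :=
    tsum_subtype U.Dom (stringWeight T)
  obtain ⟨m, N, h⟩ := exists_le_fract_partitionSum hU hT hT0 hT1
  rw [hZ]
  exact ⟨hsum, finiteStateStronglyPredictable_of_le_fract h⟩
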